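/- Let $q\in\mathbb C[z]$ be a polynomial with $q(z)=z^2+q_3z^3+O(z^4)$, let $f(z)=z+q(z)$, and for $|\delta|<1$ let $F^\delta:\mathbb C^2\to\mathbb C^2$, $$F^\delta(z,x)=\bigl(z+q(z+\delta x),\ \delta x-q(z+\delta x)\bigr).$$ Let $\mathcal B_f\subset\mathbb C$ and $\mathcal B_{F^\delta}\subset\mathbb C^2$ be the parabolic basins of the origin, i.e. the sets of points having a neighbourhood on which the iterates converge uniformly to $0$; let $\pi_z(z,x)=z$. For $b\in\mathbb C$ put $\omega^\iota_b(z)=-\frac1z-b\log(-\frac1z)$ and $\omega^o_b(z)=-\frac1z-b\log(\frac1z)$ (principal branches), and let $(\omega^o_b)^{-1}$ denote the inverse of the restriction of $\omega^o_b$ to $\{\operatorname{Re}(1/z)>|b|\}$, where $\omega_b^o$ is injective and, for each $Z\in\mathbb C$, takes the value $Z-n$ for all large $n$. Put $$b_\delta=1-q_3+\frac{2\delta}{1-\delta},\qquad\text{so that } b_0=1-q_3 .$$ The one-dimensional Fatou coordinates of $f$, $$\phi_f(z)=\lim_{n\to\infty}\bigl(\omega^\iota_{b_0}(f^n(z))-n\bigr)\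 (z\in\mathcal B_f),\qquad \psi_f(Z)=\lim_{n\to\infty}f^n\bigl((\omega^o_{b_0})^{-1}(Z-n)\bigr)\ (Z\in\mathbb C),$$ exist, are holomorphic, and satisfy $\phi_f\circ f=\phi_f+1$ and $f\circ\psi_f(Z)=\psi_f(Z+1)$. Moreover there exist families of holomorphic maps $\Phi_{F^\delta}:\mathcal B_{F^\delta}\to\mathbb C$ and $\Psi_{F^\delta}:\mathbb C\to\mathbb C^2$, defined for $|\delta|<1$, with the following properties. 1. (Abel equations.) $F^\delta(\mathcal B_{F^\delta})\subset\mathcal B_{F^\delta}$, and $\Phi_{F^\delta}\circ F^\delta=\Phi_{F^\delta}+1$ on $\mathcal B_{F^\delta}$, and $F^\delta(\Psi_{F^\delta}(Z))=\Psi_{F^\delta}(Z+1)$ for all $Z\in\mathbb C$. 2. (Normalization.) They are the attracting and repelling Fatou coordinates of $F^\delta$: $$\Phi_{F^\delta}(p)=\lim_{n\to\infty}\bigl(\omega^\iota_{b_\delta}(\pi_z((F^\delta)^n(p)))-n\bigr)\ (p\in\mathcal B_{F^\delta}),\qquad \Psi_{F^\delta}(Z)=\lim_{n\to\infty}(F^\delta)^n\bigl((\omega^o_{b_\delta})^{-1}(Z-n),0\bigr)\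 (Z\in\mathbb C).$$ 3. (Holomorphic dependence on $\delta$.) The set $\{(\delta,p):|\delta|<1,\ p\in\mathcal B_{F^\delta}\}$ is open in $\mathbb C\times\mathbb C^2$ and $(\delta,p)\mapsto\Phi_{F^\delta}(p)$ is holomorphic on it; $(\delta,Z)\mapsto\Psi_{F^\delta}(Z)$ is holomorphic on $\{|\delta|<1\}\times\mathbb C$. 4. (Degeneration.) $\mathcal B_{F^0}=\mathcal B_f\times\mathbb C$, $\ \Phi_{F^0}(z,x)=\phi_f(z)$ on $\mathcal B_{F^0}$, and $\pi_z\circ\Psi_{F^0}=\psi_f$ on $\mathbb C$. -/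

import Mathlib

open Filter Topology

noncomputable section

/-- The two-dimensional polynomial map
`F^δ (z, x) = (z + q (z + δ x), δ x - q (z + δ x))`. -/
def mapF (q : Polynomial ℂ) (δ : ℂ) (p : ℂ × ℂ) : ℂ × ℂ :=
  (p.1 + q.eval (p.1 + δ * p.2), δ * p.2 - q.eval (p.1 + δ * p.2))

/-- The one-dimensional polynomial `f z = z + q z`. -/
def mapf (q : Polynomial ℂ) (z : ℂ) : ℂ := z + q.eval z

/-- The (semi-)parabolic basin of the fixed point `0` of `T`: the set of all points having a
neighbourhood on which the iterates of `T` converge uniformly to `0`. -/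
def parabolicBasin {E : Type*} [NormedAddCommGroup E] (T : E → E) : Set E :=
  {p | ∃ V ∈ 𝓝 p, TendstoUniformlyOn (fun n : ℕ => T^[n]) (fun _ => 0) atTop V}

/-- The incoming coordinate `-1/z - b log (-1/z)` (principal branch, used where
`Re (-1/z) > 0`). -/
def omegaIn (b z : ℂ) : ℂ := -1 / z - b * Complex.log (-1 / z)

/-- The outgoing coordinate `-1/z - b log (1/z)` (principal branch, used where
`Re (1/z) > 0`). -/
def omegaOut (b z : ℂ) : ℂ := -1 / z - b * Complex.log (1 / z)

/-- The petal `{Re (1/z) > |b|}`, on which the outgoing coordinate is injective. -/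
def outPetal (b : ℂ) : Set ℂ := {z | ‖b‖ < (1 / z).re}

/-- The outgoing coordinate is injective on the petal, and there it takes the value `Z - n` for
every `Z` and all large `n`; this is the corresponding inverse. -/
def omegaOutInv (b : ℂ) : ℂ → ℂ := Function.invFunOn (omegaOut b) (outPetal b)

/-- `Φ` is the attracting Fatou coordinate of `T` on its basin, where `π` is the projection to the
`z`-coordinate and `b` is the coefficient of the logarithm in the normalization. -/
structure IsAttractingFatouCoordinate {E : Type*} [NormedAddCommGroup E] [NormedSpace ℂ E]
    (T : E → E) (π : E → ℂ) (b : ℂ) (Φ : E → ℂ) : Prop where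
  differentiableOn : DifferentiableOn ℂ Φ (parabolicBasin T)
  mapsTo : Set.MapsTo T (parabolicBasin T) (parabolicBasin T)
  abel : ∀ p ∈ parabolicBasin T, Φ (T p) = Φ p + 1
  tendsto : ∀ p ∈ parabolicBasin T,
    Tendsto (fun n : ℕ => omegaIn b (π (T^[n] p)) - (n : ℂ)) atTop (𝓝 (Φ p))

/-- `Ψ` is the repelling Fatou coordinate of `T`, where `ι` is the inclusion of the `z`-axis and
`b` is the coefficient of the logarithm in the normalization. -/
structure IsRepellingFatouCoordinate {E : Type*} [NormedAddCommGroup E] [NormedSpace ℂ E]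
    (T : E → E) (ι : ℂ → E) (b : ℂ) (Ψ : ℂ → E) : Prop where
  differentiable : Differentiable ℂ Ψ
  abel : ∀ Z : ℂ, T (Ψ Z) = Ψ (Z + 1)
  tendsto : ∀ Z : ℂ,
    Tendsto (fun n : ℕ => T^[n] (ι (omegaOutInv b (Z - (n : ℂ))))) atTop (𝓝 (Ψ Z))

/-- The coefficient `b = 1 - a₃` for `F^δ`. Here `a₃ = q₃ - 2 δ / (1 - δ)` is the coefficient of
`z³` in the `z`-component of `F^δ` after a local change of coordinates making that component
`z + z² + a₃ z³ + O(z⁴)` (equivalently, along the formally invariant curve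
`x = - z² / (1 - δ) + O(z³)`). For `δ = 0` it is `1 - q₃`, the coefficient for `f`. -/
def logCoeff (q : Polynomial ℂ) (δ : ℂ) : ℂ := 1 - (q.coeff 3 - 2 * δ / (1 - δ))

/-- The total space `{(δ, p) : |δ| < 1, p ∈ 𝓑_{F^δ}}` of the family of basins. -/
def basinFamily (q : Polynomial ℂ) : Set (ℂ × (ℂ × ℂ)) :=
  {s | ‖s.1‖ < 1 ∧ s.2 ∈ parabolicBasin (mapF q s.1)}

end

/-! Near the origin a point with `z ≠ 0` is described by `1 / z` and the slope `u = x / z + z / (1 -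
δ)`, its direction measured from the formally invariant curve. One step of `F^δ` shifts `-1 / z` by
`1 - b_δ z + O(|z|² + |u|)` and sends `u` to `δ u + O(|z| (|z| + |u|))`. The logarithm in the
coordinate `ω` cancels `b_δ z`, so `ω` moves by `1 + O(|z|² + |u|)`. These estimates, uniform for
`‖δ‖ ≤ d < 1`, are packaged in `StepBound`.

On the attracting petal `Re (-1/z)` grows at least linearly and the slopes are dominated by a
summable sequence. Hence `ω ∘ F^n - n` converges uniformly in `(δ, p)` and the limit is jointly
holomorphic. To reach the whole basin one needs every basin orbit to enter the petal. An orbit that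
stayed outside a horizontal cone would, for `δ ≠ 0`, have `x` decaying geometrically; then
horizontal derivatives of the iterates would stay bounded below, although uniform convergence to `0`
forces them to `0` (`not_mem_parabolicBasin_of_sum_le`, `frequently_mem_cone`). The case `δ = 0`
uses the open mapping theorem for `f`. Inside the cone the slope stays small and `Re (-1/z)`
increases until the orbit is in the petal (`StepBound.exists_iterate_mem_attractingPetal`).

On the repelling side, the orbit of the axis point with outgoing coordinate `Z - m`, followed for `m
- n` steps, ends within `O(1/n)` of the axis point with coordinate `Z - n`, in outgoing coordinate
and slope (`StepBound.exists_repelling_orbit`). The remaining `n` iterates do not spoil this: `F^n`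
is bounded on discs of fixed size in these coordinates, so the Schwarz lemma gives distance `O(1/n)`
(`StepBound.exists_dist_iterate_le`). The approximants are therefore uniformly Cauchy.

At `δ = 0` the projection to `z` semiconjugates `F^0` to `f`, so the one-dimensional coordinates are
read off from the two-dimensional ones. -/

/-! ### Holomorphic limits and logarithm estimates. -/

/-- Weierstrass' theorem in several variables: a locally uniform limit of holomorphic maps is
holomorphic. -/
theorem differentiableAt_of_tendstoUniformlyOn {E G : Type*} [NormedAddCommGroup E]
    [NormedSpace ℂ E] [NormedAddCommGroup G] [NormedSpace ℂ G] [CompleteSpace G]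
    {f : ℕ → E → G} {g : E → G} {U : Set E} {x : E} (hU : U ∈ 𝓝 x)
    (hf : ∀ᶠ n in atTop, DifferentiableOn ℂ (f n) U) (hlim : TendstoUniformlyOn f g atTop U) :
    DifferentiableAt ℂ g x := by
  obtain ⟨r, hr, hrU⟩ := Metric.mem_nhds_iff.1 hU
  obtain ⟨N, hN⟩ := eventually_atTop.1 hf
  have hball : ∀ y ∈ Metric.ball x (r / 2), Metric.ball y (r / 2) ⊆ U := fun y hy =>
    (Metric.ball_subset_ball' (by rw [Metric.mem_ball] at hy; linarith)).trans hrU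
  have hunif : UniformCauchySeqOn (fun n => fderiv ℂ (f (n + N))) atTop
      (Metric.ball x (r / 2)) := by
    rw [Metric.uniformCauchySeqOn_iff]
    intro η hη
    obtain ⟨K, hK⟩ := Metric.uniformCauchySeqOn_iff.1 hlim.uniformCauchySeqOn (η * r / 16)
      (by positivity)
    refine ⟨K, fun m hm n hn y hy => ?_⟩
    have hdm : DifferentiableOn ℂ (f (m + N)) (Metric.ball y (r / 2)) :=
      (hN _ (Nat.le_add_left _ _)).mono (hball y hy)
    have hdn : DifferentiableOn ℂ (f (n + N)) (Metric.ball y (r / 2)) :=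
      (hN _ (Nat.le_add_left _ _)).mono (hball y hy)
    have hy0 : y ∈ Metric.ball y (r / 2) := Metric.mem_ball_self (by positivity)
    have hnhds : Metric.ball y (r / 2) ∈ 𝓝 y := Metric.ball_mem_nhds _ (by positivity)
    have hsmall : ∀ w ∈ Metric.ball y (r / 2), ‖(f (m + N) - f (n + N)) w‖ ≤ η * r / 16 :=
      fun w hw => by
        have := hK (m + N) (by omega) (n + N) (by omega) w (hball y hy hw)
        rw [dist_eq_norm] at this
        exact this.le
    -- Cauchy's estimate on the ball of radius `r / 2` about `y` gives `(η r / 8) / (r / 2) = η /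
    -- 4`, so the derivatives are uniformly Cauchy.
    have hb := Complex.norm_fderiv_le_div_of_mapsTo_ball (R₂ := η * r / 8) (hdm.sub hdn)
      (fun w hw => by
        rw [Metric.mem_closedBall, dist_eq_norm]
        refine (norm_sub_le _ _).trans ?_
        linarith [hsmall w hw, hsmall y hy0]) (by positivity)
    rw [dist_eq_norm, ← fderiv_sub (hdm.differentiableAt hnhds) (hdn.differentiableAt hnhds)]
    refine hb.trans_lt ?_
    rw [div_lt_iff₀ (by positivity)]
    nlinarith [mul_pos hη hr]
  have hpt : ∀ y ∈ Metric.ball x (r / 2),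
      Tendsto (fun n => fderiv ℂ (f (n + N)) y) atTop
        (𝓝 (limUnder atTop fun n => fderiv ℂ (f (n + N)) y)) := fun y hy =>
    (hunif.cauchySeq hy).tendsto_limUnder
  have hx : x ∈ Metric.ball x (r / 2) := Metric.mem_ball_self (by positivity)
  have hsub : ∀ y ∈ Metric.ball x (r / 2), y ∈ U := fun y hy =>
    hball y hy (Metric.mem_ball_self (by positivity))
  refine (hasFDerivAt_of_tendstoUniformlyOn (l := atTop) (f := fun n => f (n + N))
    Metric.isOpen_ball (hunif.tendstoUniformlyOn_of_tendsto hpt) ?_ ?_ hx).differentiableAt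
  · exact fun n y hy => ((hN _ (Nat.le_add_left _ _)).differentiableAt
      (mem_of_superset (Metric.ball_mem_nhds _ (by positivity)) (hball y hy))).hasFDerivAt
  · exact fun y hy => (tendsto_add_atTop_iff_nat N).2 (hlim.tendsto_at (hsub y hy))

/-- Write `W' = W (1 + t)` with `|t| ≤ 1/2`. Both factors have argument in `(-π/2, π/2)`, so the
principal logarithm is additive on this product, and `log (1 + t) - t` is a second-order Taylor
remainder. -/
theorem norm_log_sub_log_sub_le {W W' : ℂ} (hW : 0 < W.re) (hW' : 0 < W'.re)
    (h : ‖W' - W‖ ≤ ‖W‖ / 2) :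
    ‖Complex.log W' - Complex.log W - (W' - W) / W‖ ≤ ‖(W' - W) / W‖ ^ 2 := by
  have hW0 : W ≠ 0 := by rintro rfl; simp at hW
  have hW0' : W' ≠ 0 := by rintro rfl; simp at hW'
  set t : ℂ := (W' - W) / W with ht
  have htn : ‖t‖ ≤ 1 / 2 := by
    rw [ht, norm_div, div_le_iff₀ (norm_pos_iff.2 hW0)]; linarith
  have ht1 : 0 < (1 + t).re := by
    have := (Complex.abs_re_le_norm t).trans htn
    rw [Complex.add_re, Complex.one_re]
    linarith [neg_abs_le t.re]
  have ht0 : 1 + t ≠ 0 := by intro h; rw [h] at ht1; simp at ht1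
  have hWt : W' = W * (1 + t) := by rw [ht]; field_simp; ring
  have a1 := abs_lt.1 (Complex.abs_arg_lt_pi_div_two_iff.2 (Or.inl hW))
  have a2 := abs_lt.1 (Complex.abs_arg_lt_pi_div_two_iff.2 (Or.inl ht1))
  have hlog : Complex.log W' = Complex.log W + Complex.log (1 + t) := by
    rw [hWt]
    exact Complex.log_mul hW0 ht0 ⟨by linarith [a1.1, a2.1], by linarith [a1.2, a2.2]⟩
  rw [hlog, add_sub_cancel_left]
  refine (Complex.norm_log_one_add_sub_self_le (htn.trans_lt (by norm_num))).trans ?_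
  have : (1 - ‖t‖)⁻¹ ≤ 2 := by
    rw [inv_le_comm₀ (by linarith) two_pos]; linarith
  nlinarith [sq_nonneg ‖t‖]

theorem norm_log_sub_log_le {W W' : ℂ} {m : ℝ} (hm : 0 < m) (hW : m ≤ W.re) (hW' : m ≤ W'.re) :
    ‖Complex.log W' - Complex.log W‖ ≤ m⁻¹ * ‖W' - W‖ := by
  refine (convex_halfSpace_re_ge m).norm_image_sub_le_of_norm_hasDerivWithin_le
    (f := Complex.log) (f' := fun w => w⁻¹) (fun w hw => ?_) (fun w hw => ?_) hW hW'
  · exact (Complex.hasDerivAt_log (Or.inl (hm.trans_le hw))).hasDerivWithinAt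
  · rw [norm_inv]
    exact inv_anti₀ hm (le_trans hw ((le_abs_self _).trans (Complex.abs_re_le_norm w)))

theorem summable_of_le_mul_add {u s : ℕ → ℝ} {r : ℝ} (hu : ∀ n, 0 ≤ u n) (hs0 : ∀ n, 0 ≤ s n)
    (hr : r < 1) (hs : Summable s) (h : ∀ n, u (n + 1) ≤ r * u n + s n) :
    Summable u := by
  refine summable_of_sum_range_le (c := (u 0 + ∑' n, s n) / (1 - r)) hu fun n => ?_
  rw [le_div_iff₀ (by linarith)]
  have h1 : ∑ i ∈ Finset.range (n + 1), u i ≤ u 0 + r * ∑ i ∈ Finset.range n, u i + ∑' n, s n := by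
    rw [Finset.sum_range_succ', Finset.mul_sum]
    have h2 := Finset.sum_le_sum fun i (_ : i ∈ Finset.range n) => h i
    rw [Finset.sum_add_distrib] at h2
    have h3 := hs.sum_le_tsum (Finset.range n) fun i _ => hs0 i
    linarith
  have h4 := Finset.sum_range_succ u n
  nlinarith [hu n]

/-- `log` is `o(W)` with explicit constants. -/
theorem exists_norm_mul_log_le (β : ℝ) : ∃ C : ℝ, 0 ≤ C ∧ ∀ b W : ℂ, ‖b‖ ≤ β → 1 ≤ W.re →
    ‖b * Complex.log W‖ ≤ ‖W‖ / 8 + C := by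
  by_cases hβ : β < 0
  · exact ⟨0, le_rfl, fun b W hb _ => absurd (norm_nonneg b) (by linarith)⟩
  push Not at hβ
  -- Chosen so that `β η ≤ 1/8`; the inequality `log y ≤ y - 1` at `y = η ‖W‖` then makes the
  -- logarithm small relative to `‖W‖`.
  set η : ℝ := 1 / (8 * (β + 1)) with hη
  have hηpos : 0 < η := by positivity
  refine ⟨β * (|Real.log η| + Real.pi), by positivity, fun b W hb hW => ?_⟩
  have hWn : 1 ≤ ‖W‖ := hW.trans ((le_abs_self _).trans (Complex.abs_re_le_norm W))
  have h1 : ‖Complex.log W‖ ≤ Real.log ‖W‖ + Real.pi := by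
    refine (Complex.norm_le_abs_re_add_abs_im _).trans ?_
    rw [Complex.log_re, Complex.log_im, abs_of_nonneg (Real.log_nonneg hWn)]
    gcongr
    exact Complex.abs_arg_le_pi W
  have h2 : Real.log ‖W‖ ≤ η * ‖W‖ + |Real.log η| := by
    have := Real.log_le_sub_one_of_pos (mul_pos hηpos (by linarith : 0 < ‖W‖))
    rw [Real.log_mul hηpos.ne' (by linarith)] at this
    linarith [neg_abs_le (Real.log η)]
  have h3 : β * η ≤ 1 / 8 := by
    rw [hη, mul_one_div, div_le_div_iff₀ (by positivity) (by norm_num)]; linarith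
  calc ‖b * Complex.log W‖ ≤ β * (η * ‖W‖ + |Real.log η| + Real.pi) := by
        rw [norm_mul]; gcongr; linarith
    _ = β * η * ‖W‖ + β * (|Real.log η| + Real.pi) := by ring
    _ ≤ _ := by nlinarith

/-! ### One-step estimates near the origin. -/

theorem exists_eval_eq_sq_add (q : Polynomial ℂ) (h0 : q.coeff 0 = 0) (h1 : q.coeff 1 = 0)
    (h2 : q.coeff 2 = 1) : ∃ r : Polynomial ℂ, ∀ w : ℂ,
      q.eval w = w ^ 2 + q.coeff 3 * w ^ 3 + w ^ 4 * r.eval w := by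
  refine ⟨q.divX.divX.divX.divX, fun w => ?_⟩
  have e : ∀ p : Polynomial ℂ, p.eval w = p.divX.eval w * w + p.coeff 0 := fun p => by
    conv_lhs => rw [← Polynomial.divX_mul_X_add p]
    simp
  rw [e q, e q.divX, e q.divX.divX, e q.divX.divX.divX]
  simp only [Polynomial.coeff_divX, h0, h1, h2, zero_add]
  ring

theorem exists_norm_eval_le (r : Polynomial ℂ) : ∃ B : ℝ, 0 ≤ B ∧ ∀ w : ℂ, ‖w‖ ≤ 2 →
    ‖r.eval w‖ ≤ B := by
  obtain ⟨B, hB⟩ := (isCompact_closedBall (0 : ℂ) 2).exists_bound_of_continuousOn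
    (f := fun w => r.eval w) r.continuous.continuousOn
  exact ⟨max B 0, le_max_right _ _, fun w hw =>
    (hB w (by simpa using hw)).trans (le_max_left _ _)⟩

/-- The direction `x / z`, measured from the formally invariant curve `x = - z² / (1 - δ)`. -/
noncomputable def slope2 (δ : ℂ) (p : ℂ × ℂ) : ℂ := p.2 / p.1 + p.1 / (1 - δ)

theorem snd_eq_slope2 {δ : ℂ} {p : ℂ × ℂ} (hp : p.1 ≠ 0) :
    p.2 = p.1 * (slope2 δ p - p.1 / (1 - δ)) := by
  rw [slope2]; field_simp; ring

theorem norm_inv_one_sub_le {δ : ℂ} {d : ℝ} (hd : d < 1) (hδ : ‖δ‖ ≤ d) :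
    ‖(1 - δ)⁻¹‖ ≤ (1 - d)⁻¹ := by
  rw [norm_inv]
  refine inv_anti₀ (by linarith) ?_
  have := norm_sub_norm_le (1 : ℂ) δ
  rw [norm_one] at this
  linarith

theorem one_sub_ne_zero {δ : ℂ} (hδ : ‖δ‖ < 1) : 1 - δ ≠ 0 := by
  intro h
  rw [← sub_eq_zero.1 h] at hδ
  simp at hδ

theorem norm_logCoeff_le (q : Polynomial ℂ) {δ : ℂ} {d : ℝ} (hd : d < 1) (hδ : ‖δ‖ ≤ d) :
    ‖logCoeff q δ‖ ≤ 1 + ‖q.coeff 3‖ + 2 * (1 - d)⁻¹ := by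
  have h := norm_inv_one_sub_le hd hδ
  have : logCoeff q δ = 1 + (-q.coeff 3) + 2 * δ * (1 - δ)⁻¹ := by rw [logCoeff]; ring
  rw [this]
  refine (norm_add_le _ _).trans (add_le_add ((norm_add_le _ _).trans (by simp)) ?_)
  rw [norm_mul, norm_mul, Complex.norm_ofNat]
  nlinarith [norm_nonneg δ, norm_nonneg (1 - δ)⁻¹]

/-- `A = q(w)/z²` for `w = z + δ x = z σ`, the relative displacement being `z A`. -/
theorem mapF_eq_of_factor {q r : Polynomial ℂ}
    (hr : ∀ w : ℂ, q.eval w = w ^ 2 + q.coeff 3 * w ^ 3 + w ^ 4 * r.eval w)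
    {δ z u e v A : ℂ} (hv : v = δ * (u - e * z))
    (hA : A = (1 + v) ^ 2 + q.coeff 3 * z * (1 + v) ^ 3
      + z ^ 2 * (1 + v) ^ 4 * r.eval (z * (1 + v))) :
    mapF q δ (z, z * (u - e * z)) =
      (z * (1 + z * A), z * (v - z * A)) := by
  have hw : z + δ * (z * (u - e * z)) = z * (1 + v) := by rw [hv]; ring
  have hqw : q.eval (z * (1 + v)) = z ^ 2 * A := by rw [hr, hA]; ring
  simp only [mapF, hw, hqw, Prod.mk.injEq]
  exact ⟨by ring, by rw [hv]; ring⟩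

/-- Used with `s = 1 + z A`: it removes this denominator from the drift and slope errors. -/
theorem norm_le_two_mul_of_eq_mul {N t s : ℂ} {c : ℝ} (hs : 1 / 2 ≤ ‖s‖) (h : N = t * s)
    (hc : ‖N‖ ≤ c) : ‖t‖ ≤ 2 * c := by
  rw [h, norm_mul] at hc
  have := mul_le_mul_of_nonneg_left hs (norm_nonneg t)
  linarith

theorem norm_displacement_sub_one_le {z v A c ρ : ℂ} {m μ E a B : ℝ} (hz : ‖z‖ = m) (hm : m ≤ 1)
    (hμ0 : 0 ≤ μ) (hv : ‖v‖ ≤ μ + E * m) (hv1 : ‖v‖ ≤ 1) (hc : ‖c‖ = a) (hρ : ‖ρ‖ ≤ B)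
    (hE : 1 ≤ E) (hB : 0 ≤ B)
    (hA : A = (1 + v) ^ 2 + c * z * (1 + v) ^ 3 + z ^ 2 * (1 + v) ^ 4 * ρ) :
    ‖z ^ 2 * (1 + v) ^ 4 * ρ‖ ≤ m ^ 2 * 16 * B ∧
      ‖A - 1‖ ≤ (3 * E + 8 * a + 16 * B) * (m + μ) := by
  have hm0 : 0 ≤ m := hz ▸ norm_nonneg z
  have ha0 : 0 ≤ a := hc ▸ norm_nonneg c
  have hσ : ‖1 + v‖ ≤ 2 := (norm_add_le _ _).trans (by rw [norm_one]; linarith)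
  have hσ4 : ‖z ^ 2 * (1 + v) ^ 4 * ρ‖ ≤ m ^ 2 * 16 * B := by
    rw [norm_mul, norm_mul, norm_pow, norm_pow, hz]
    calc m ^ 2 * ‖1 + v‖ ^ 4 * ‖ρ‖ ≤ m ^ 2 * 2 ^ 4 * B := by gcongr
      _ = _ := by ring
  refine ⟨hσ4, ?_⟩
  have e1 : A - 1 = v * (2 + v) + c * z * (1 + v) ^ 3 + z ^ 2 * (1 + v) ^ 4 * ρ := by
    rw [hA]; ring
  have e2 : ‖v * (2 + v)‖ ≤ (μ + E * m) * 3 := by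
    rw [norm_mul]; gcongr
    exact (norm_add_le _ _).trans (by rw [Complex.norm_ofNat]; linarith)
  have e3 : ‖c * z * (1 + v) ^ 3‖ ≤ a * m * 2 ^ 3 := by
    rw [norm_mul, norm_mul, norm_pow, hz, hc]; gcongr
  rw [e1]
  refine (norm_add₃_le).trans ((add_le_add (add_le_add e2 e3) hσ4).trans ?_)
  have h5 : m ^ 2 * 16 * B ≤ m * 16 * B := by gcongr; nlinarith
  have h6 : μ ≤ E * μ := le_mul_of_one_le_left hμ0 hE
  have h7 := mul_nonneg ha0 hμ0
  have h8 := mul_nonneg hB hμ0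
  linarith

/-- With `z' = z (1 + z A)` one has `1/z - 1/z' = A / (1 + z A)`. To first order in `z`, with `u =
0`, `A` is `1 + (c - 2 δ e) z`, so the quotient is `1 + (c - 1 - 2 δ e) z = 1 - b z`; this is what
determines `b`. What remains is quadratic in `z` or carries a factor `u`. -/
theorem norm_drift_le {z u v e δ A b c ρ : ℂ} {m μ E a B C₁ β : ℝ} (hz0 : z ≠ 0)
    (hz : ‖z‖ = m) (hu : ‖u‖ = μ) (hm1 : m ≤ 1) (hμ1 : μ ≤ 1) (hδ : ‖δ‖ ≤ 1)
    (hv : v = δ * (u - e * z)) (hvn : ‖v‖ ≤ μ + E * m) (hv1 : ‖v‖ ≤ 1) (hc : ‖c‖ = a)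
    (hE : 1 ≤ E) (hB : 0 ≤ B) (hC₁ : 0 ≤ C₁) (hb : b = 1 - c + 2 * δ * e) (hbβ : ‖b‖ ≤ β)
    (hA : A = (1 + v) ^ 2 + c * z * (1 + v) ^ 3 + z ^ 2 * (1 + v) ^ 4 * ρ)
    (hσ4 : ‖z ^ 2 * (1 + v) ^ 4 * ρ‖ ≤ m ^ 2 * 16 * B)
    (hA1 : ‖A - 1‖ ≤ C₁ * (m + μ)) (hA2 : ‖A‖ ≤ 2) (hzA : 1 / 2 ≤ ‖1 + z * A‖) :
    ‖1 / z - 1 / (z * (1 + z * A)) - 1 + b * z‖ ≤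
      2 * ((2 + (2 + 2 * E ^ 2) + 7 * a * (1 + E) + 16 * B + 2 * C₁ + 2 * β) * (m ^ 2 + μ)) := by
  have hm0 : 0 ≤ m := hz ▸ norm_nonneg z
  have hμ0 : 0 ≤ μ := hu ▸ norm_nonneg u
  have ha0 : 0 ≤ a := hc ▸ norm_nonneg c
  have hβ0 : 0 ≤ β := (norm_nonneg b).trans hbβ
  have hzA0 : 1 + z * A ≠ 0 := by
    intro h; rw [h, norm_zero] at hzA; linarith
  have hm2 : 0 ≤ m ^ 2 := sq_nonneg m
  have hmμ : m * μ ≤ μ := mul_le_of_le_one_left hμ0 hm1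
  have key : 2 * δ * u + v ^ 2 + c * z * (v * (3 + 3 * v + v ^ 2))
      + z ^ 2 * (1 + v) ^ 4 * ρ - z * (A - 1) + b * z ^ 2 * A
      = (1 / z - 1 / (z * (1 + z * A)) - 1 + b * z) * (1 + z * A) := by
    have h3 : (1 / z - 1 / (z * (1 + z * A)) - 1 + b * z) * (1 + z * A)
        = A - (1 - b * z) * (1 + z * A) := by
      field_simp; ring
    have h4 : 2 * δ * u + v ^ 2 + c * z * (v * (3 + 3 * v + v ^ 2))
      + z ^ 2 * (1 + v) ^ 4 * ρ = A - 1 + (b - 1) * z := by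
      rw [hA, hb, hv]; ring
    rw [h3, h4]; ring
  refine norm_le_two_mul_of_eq_mul hzA key ?_
  have t1 : ‖2 * δ * u‖ ≤ 2 * (m ^ 2 + μ) := by
    rw [norm_mul, norm_mul, Complex.norm_ofNat, hu]
    have := mul_le_of_le_one_left hμ0 hδ
    linarith
  have t2 : ‖v ^ 2‖ ≤ (2 + 2 * E ^ 2) * (m ^ 2 + μ) := by
    rw [norm_pow]
    have h5 : ‖v‖ ^ 2 ≤ (μ + E * m) ^ 2 := by gcongr
    have h6 : (μ + E * m) ^ 2 ≤ 2 * μ ^ 2 + 2 * (E ^ 2 * m ^ 2) := by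
      nlinarith [sq_nonneg (μ - E * m)]
    have h7 : μ ^ 2 ≤ μ := by nlinarith
    have h8 : 0 ≤ E ^ 2 * μ := by positivity
    linarith
  have t3 : ‖c * z * (v * (3 + 3 * v + v ^ 2))‖ ≤ 7 * a * (1 + E) * (m ^ 2 + μ) := by
    have h5 : ‖3 + 3 * v + v ^ 2‖ ≤ 7 := by
      refine norm_add₃_le.trans ?_
      rw [norm_mul, norm_pow, Complex.norm_ofNat]
      nlinarith [norm_nonneg v]
    rw [norm_mul, norm_mul, norm_mul, hc, hz]
    calc a * m * (‖v‖ * ‖3 + 3 * v + v ^ 2‖)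
        ≤ a * m * ((μ + E * m) * 7) := by gcongr
      _ = 7 * a * (m * μ + E * m ^ 2) := by ring
      _ ≤ 7 * a * ((1 + E) * (m ^ 2 + μ)) := by
        gcongr
        have : 0 ≤ E * μ := by positivity
        linarith
      _ = _ := by ring
  have t4 : ‖b * z ^ 2 * A‖ ≤ 2 * β * (m ^ 2 + μ) := by
    rw [norm_mul, norm_mul, norm_pow, hz]
    calc ‖b‖ * m ^ 2 * ‖A‖ ≤ β * m ^ 2 * 2 := by gcongr
      _ ≤ _ := by have := mul_nonneg hβ0 hμ0; linarith
  have t5 : ‖z * (A - 1)‖ ≤ 2 * C₁ * (m ^ 2 + μ) := by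
    rw [norm_mul, hz]
    calc m * ‖A - 1‖ ≤ m * (C₁ * (m + μ)) := by gcongr
      _ = C₁ * (m ^ 2 + m * μ) := by ring
      _ ≤ C₁ * (2 * (m ^ 2 + μ)) := by gcongr; linarith
      _ = _ := by ring
  have t6 : m ^ 2 * 16 * B ≤ 16 * B * (m ^ 2 + μ) := by
    have := mul_nonneg hB hμ0
    linarith
  have s1 := norm_add_le (2 * δ * u + v ^ 2 + c * z * (v * (3 + 3 * v + v ^ 2))
    + z ^ 2 * (1 + v) ^ 4 * ρ - z * (A - 1)) (b * z ^ 2 * A)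
  have s2 := norm_sub_le (2 * δ * u + v ^ 2 + c * z * (v * (3 + 3 * v + v ^ 2))
    + z ^ 2 * (1 + v) ^ 4 * ρ) (z * (A - 1))
  have s3 := norm_add_le (2 * δ * u + v ^ 2 + c * z * (v * (3 + 3 * v + v ^ 2)))
    (z ^ 2 * (1 + v) ^ 4 * ρ)
  have s4 := norm_add₃_le (a := 2 * δ * u) (b := v ^ 2)
    (c := c * z * (v * (3 + 3 * v + v ^ 2)))
  linarith

/-- The terms linear in `z` are `(-δ e - 1 + e) z`, and they cancel because `(1 - δ) e = 1`. This is
why the slope is measured from the curve `x = -z² / (1 - δ)`. -/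
theorem norm_slope_step_le {z u v e δ A : ℂ} {m μ E C₁ : ℝ} (hz0 : z ≠ 0)
    (hz : ‖z‖ = m) (hu : ‖u‖ = μ) (hm1 : m ≤ 1) (hδ : ‖δ‖ ≤ 1) (hδ1 : 1 - δ ≠ 0)
    (he : e = (1 - δ)⁻¹) (heE : ‖e‖ ≤ E) (hv : v = δ * (u - e * z))
    (hA1 : ‖A - 1‖ ≤ C₁ * (m + μ)) (hA2 : ‖A‖ ≤ 2) (hzA : 1 / 2 ≤ ‖1 + z * A‖) :
    ‖slope2 δ (z * (1 + z * A), z * (v - z * A)) - δ * u‖ ≤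
      2 * ((2 + C₁ + 8 * E) * (m * (m + μ))) := by
  have hm0 : 0 ≤ m := hz ▸ norm_nonneg z
  have hμ0 : 0 ≤ μ := hu ▸ norm_nonneg u
  have hE0 : 0 ≤ E := (norm_nonneg e).trans heE
  have hzA0 : 1 + z * A ≠ 0 := by
    intro h; rw [h, norm_zero] at hzA; linarith
  have hs : slope2 δ (z * (1 + z * A), z * (v - z * A)) =
      (v - z * A) / (1 + z * A) + z * (1 + z * A) * e := by
    rw [slope2, he, ← div_eq_mul_inv, mul_div_mul_left _ _ hz0]
  have hδe : (1 - δ) * e = 1 := by rw [he]; exact mul_inv_cancel₀ hδ1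
  have key : -(z * A * δ * u) - z * (A - 1) + (2 * z ^ 2 * A + z ^ 3 * A ^ 2) * e
      = (slope2 δ (z * (1 + z * A), z * (v - z * A)) - δ * u) * (1 + z * A) := by
    have h3 : ((v - z * A) / (1 + z * A) + z * (1 + z * A) * e - δ * u) * (1 + z * A)
        = (v - z * A) + z * (1 + z * A) ^ 2 * e - δ * u * (1 + z * A) := by
      field_simp
    rw [hs, h3, hv]
    linear_combination (- z) * hδe
  refine norm_le_two_mul_of_eq_mul hzA key ?_
  have t1 : ‖z * A * δ * u‖ ≤ 2 * (m * (m + μ)) := by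
    rw [norm_mul, norm_mul, norm_mul, hz, hu]
    calc m * ‖A‖ * ‖δ‖ * μ ≤ m * 2 * 1 * μ := by gcongr
      _ ≤ _ := by nlinarith
  have t2 : ‖(2 * z ^ 2 * A + z ^ 3 * A ^ 2) * e‖ ≤ 8 * E * (m * (m + μ)) := by
    have t3 : ‖2 * z ^ 2 * A + z ^ 3 * A ^ 2‖ ≤ 2 * m ^ 2 * 2 + m ^ 3 * 2 ^ 2 := by
      refine (norm_add_le _ _).trans ?_
      simp only [norm_mul, norm_pow, Complex.norm_ofNat, hz]
      gcongr
    have t4 : m ^ 3 ≤ m ^ 2 := pow_le_pow_of_le_one hm0 hm1 (by norm_num)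
    have t5 : 0 ≤ m * μ := mul_nonneg hm0 hμ0
    rw [norm_mul]
    calc _ ≤ (2 * m ^ 2 * 2 + m ^ 3 * 2 ^ 2) * E := by gcongr
      _ ≤ (8 * (m * (m + μ))) * E := by
        gcongr
        linarith
      _ = _ := by ring
  have t6 : ‖z * (A - 1)‖ ≤ C₁ * (m * (m + μ)) := by
    rw [norm_mul, hz]
    calc m * ‖A - 1‖ ≤ m * (C₁ * (m + μ)) := by gcongr
      _ = _ := by ring
  refine (norm_add_le _ _).trans ((add_le_add_left (norm_sub_le _ _) _).trans ?_)
  rw [norm_neg]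
  linarith

/-- The one-step estimates near the origin, uniform in `‖δ‖ ≤ d`. -/
theorem exists_drift_slope_bound (q : Polynomial ℂ) (h0 : q.coeff 0 = 0) (h1 : q.coeff 1 = 0)
    (h2 : q.coeff 2 = 1) {d : ℝ} (hd0 : 0 ≤ d) (hd : d < 1) :
    ∃ C ε : ℝ, 1 ≤ C ∧ 0 < ε ∧ ε ≤ 1 ∧ ∀ (δ : ℂ) (p : ℂ × ℂ), ‖δ‖ ≤ d → p.1 ≠ 0 → ‖p.1‖ ≤ ε →
      ‖slope2 δ p‖ ≤ ε →
      (mapF q δ p).1 ≠ 0 ∧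
      ‖1 / p.1 - 1 / (mapF q δ p).1 - 1 + logCoeff q δ * p.1‖ ≤ C * (‖p.1‖ ^ 2 + ‖slope2 δ p‖) ∧
      ‖slope2 δ (mapF q δ p) - δ * slope2 δ p‖ ≤ C * (‖p.1‖ * (‖p.1‖ + ‖slope2 δ p‖)) := by
  obtain ⟨r, hr⟩ := exists_eval_eq_sq_add q h0 h1 h2
  obtain ⟨B, hB0, hB⟩ := exists_norm_eval_le r
  obtain ⟨a, ha⟩ : ∃ a, ‖q.coeff 3‖ = a := ⟨_, rfl⟩
  have ha0 : 0 ≤ a := ha ▸ norm_nonneg _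
  obtain ⟨E, hE⟩ : ∃ E, (1 - d)⁻¹ = E := ⟨_, rfl⟩
  have hE1 : 1 ≤ E := by rw [← hE]; exact (one_le_inv₀ (by linarith)).2 (by linarith)
  obtain ⟨C₁, hC₁⟩ : ∃ C₁, C₁ = 3 * E + 8 * a + 16 * B := ⟨_, rfl⟩
  have hC₁1 : 1 ≤ C₁ := by rw [hC₁]; linarith
  have hE2 : 0 ≤ E ^ 2 := by positivity
  have haE : 0 ≤ a * (1 + E) := by positivity
  have hεC : C₁ * (1 / (4 * C₁)) = 1 / 4 := by field_simp
  -- The constant is the sum of the drift and slope constants. The radius `1 / (4 C₁)` gives `‖A -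
  -- 1‖ ≤ 1/2`, hence `‖A‖ ≤ 2` and `‖1 + z A‖ ≥ 1/2`.
  refine ⟨2 * (2 + (2 + 2 * E ^ 2) + 7 * a * (1 + E) + 16 * B + 2 * C₁ + 2 * (1 + a + 2 * E))
    + 2 * (2 + C₁ + 8 * E), 1 / (4 * C₁), by linarith, by positivity, ?_, ?_⟩
  · rw [div_le_one (by positivity)]; linarith
  rintro δ ⟨z, x⟩ hδ hz hzε huε
  simp only at hz hzε huε ⊢
  generalize 1 / (4 * C₁) = ε at hzε huε hεC
  have hε1 : ε ≤ 1 / 4 := by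
    have := mul_le_mul_of_nonneg_right hC₁1 ((norm_nonneg z).trans hzε)
    linarith
  obtain ⟨u, hu⟩ : ∃ u, slope2 δ (z, x) = u := ⟨_, rfl⟩
  obtain ⟨e, he⟩ : ∃ e, e = (1 - δ)⁻¹ := ⟨_, rfl⟩
  have heE : ‖e‖ ≤ E := by rw [he, ← hE]; exact norm_inv_one_sub_le hd hδ
  have hδ1 : ‖δ‖ ≤ 1 := by linarith
  have hδe : 1 - δ ≠ 0 := one_sub_ne_zero (by linarith)
  have hx : x = z * (u - e * z) := by
    have := snd_eq_slope2 (δ := δ) (p := (z, x)) hz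
    simp only [hu] at this
    rw [this, he]; ring
  obtain ⟨v, hv⟩ : ∃ v, v = δ * (u - e * z) := ⟨_, rfl⟩
  obtain ⟨ρ, hρ⟩ : ∃ ρ, ρ = r.eval (z * (1 + v)) := ⟨_, rfl⟩
  obtain ⟨A, hA⟩ : ∃ A, A = (1 + v) ^ 2 + q.coeff 3 * z * (1 + v) ^ 3
      + z ^ 2 * (1 + v) ^ 4 * r.eval (z * (1 + v)) := ⟨_, rfl⟩
  have hF := mapF_eq_of_factor hr hv hA
  rw [← hx] at hF
  rw [← hρ] at hA
  rw [hu] at huε ⊢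
  obtain ⟨m, hm⟩ : ∃ m, ‖z‖ = m := ⟨_, rfl⟩
  obtain ⟨μ, hμ⟩ : ∃ μ, ‖u‖ = μ := ⟨_, rfl⟩
  have hm0 : 0 ≤ m := hm ▸ norm_nonneg _
  have hμ0 : 0 ≤ μ := hμ ▸ norm_nonneg _
  rw [hF, hm, hμ]
  rw [hm] at hzε
  rw [hμ] at huε
  have hvn : ‖v‖ ≤ μ + E * m := by
    have h3 : ‖u - e * z‖ ≤ μ + E * m :=
      (norm_sub_le _ _).trans (by rw [norm_mul, hm, hμ]; gcongr)
    rw [hv, norm_mul]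
    exact (mul_le_of_le_one_left (norm_nonneg _) hδ1).trans h3
  have hv1 : ‖v‖ ≤ 1 := by
    have : E * m ≤ C₁ * ε := mul_le_mul (by linarith) hzε hm0 (by linarith)
    linarith
  have hρB : ‖ρ‖ ≤ B := by
    rw [hρ]; refine hB _ ?_
    have := norm_add_le 1 v
    rw [norm_one] at this
    rw [norm_mul, hm]
    nlinarith [norm_nonneg (1 + v)]
  obtain ⟨hσ4, hA1⟩ := norm_displacement_sub_one_le hm (by linarith) hμ0 hvn hv1 ha hρB hE1 hB0 hA
  rw [← hC₁] at hA1
  have hA2 : ‖A - 1‖ ≤ 1 := by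
    have := mul_le_mul_of_nonneg_left (add_le_add hzε huε) (by linarith : 0 ≤ C₁)
    linarith
  have hAn : ‖A‖ ≤ 2 := by
    have h3 : A = 1 + (A - 1) := by ring
    rw [h3]; exact (norm_add_le _ _).trans (by rw [norm_one]; linarith)
  have hzA : 1 / 2 ≤ ‖1 + z * A‖ := by
    have h3 := norm_sub_norm_le (1 : ℂ) (-(z * A))
    rw [norm_neg, norm_one, norm_mul, sub_neg_eq_add, hm] at h3
    have h4 : m * ‖A‖ ≤ 1 / 4 * 2 := mul_le_mul (by linarith) hAn (norm_nonneg _) (by norm_num)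
    linarith
  have hzA0 : 1 + z * A ≠ 0 := by
    intro h; rw [h, norm_zero] at hzA; linarith
  have hβb : ‖logCoeff q δ‖ ≤ 1 + a + 2 * E := by
    rw [← ha, ← hE]; exact norm_logCoeff_le q hd hδ
  have hb : logCoeff q δ = 1 - q.coeff 3 + 2 * δ * e := by rw [logCoeff, he]; ring
  refine ⟨mul_ne_zero hz hzA0, ?_, ?_⟩
  · refine (norm_drift_le hz hm hμ (by linarith) (by linarith) hδ1 hv hvn hv1 ha hE1 hB0
      (by linarith) hb hβb hA hσ4 hA1 hAn hzA).trans ?_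
    rw [← mul_assoc]
    gcongr ?_ * _
    linarith
  · refine (norm_slope_step_le hz hm hμ (by linarith) hδ1 hδe he heE hv hA1 hAn hzA).trans ?_
    rw [← mul_assoc]
    gcongr ?_ * _
    linarith

/-- Uniform one-step estimates for `mapF q δ`, `‖δ‖ ≤ d`, near the origin. -/
structure StepBound (q : Polynomial ℂ) (d C ε : ℝ) : Prop where
  d_nonneg : 0 ≤ d
  d_lt_one : d < 1
  one_le : 1 ≤ C
  eps_pos : 0 < ε
  eps_le : ε ≤ 1 / 4
  logCoeff_le : ∀ δ : ℂ, ‖δ‖ ≤ d → ‖logCoeff q δ‖ ≤ C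
  step : ∀ (δ : ℂ) (p : ℂ × ℂ), ‖δ‖ ≤ d → p.1 ≠ 0 → ‖p.1‖ ≤ ε → ‖slope2 δ p‖ ≤ ε →
    (mapF q δ p).1 ≠ 0 ∧ ‖1 / p.1 - 1 / (mapF q δ p).1 - 1‖ ≤ 1 / 4 ∧
      ‖slope2 δ (mapF q δ p)‖ ≤ (1 + d) / 2 * ‖slope2 δ p‖ + C * ‖p.1‖ ^ 2
  step_in : ∀ (δ : ℂ) (p : ℂ × ℂ), ‖δ‖ ≤ d → p.1 ≠ 0 → ‖p.1‖ ≤ ε → ‖slope2 δ p‖ ≤ ε →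
    0 < (-1 / p.1).re → 0 < (-1 / (mapF q δ p).1).re →
    ‖omegaIn (logCoeff q δ) (mapF q δ p).1 - omegaIn (logCoeff q δ) p.1 - 1‖ ≤
      C * (‖p.1‖ ^ 2 + ‖slope2 δ p‖)
  step_out : ∀ (δ : ℂ) (p : ℂ × ℂ), ‖δ‖ ≤ d → p.1 ≠ 0 → ‖p.1‖ ≤ ε → ‖slope2 δ p‖ ≤ ε →
    0 < (1 / p.1).re → 0 < (1 / (mapF q δ p).1).re →
    ‖omegaOut (logCoeff q δ) (mapF q δ p).1 - omegaOut (logCoeff q δ) p.1 - 1‖ ≤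
      C * (‖p.1‖ ^ 2 + ‖slope2 δ p‖)

/-- Here `D` is the increment `1/z - 1/z'` and `l` that of the logarithm. Since `l` is `-z D` up to
second order, `-b l` cancels the drift `-b z` in `D - 1`, which by itself would not be summable
along orbits. -/
theorem norm_log_correction_le {z D b l : ℂ} {C β μ : ℝ} (hC : 0 ≤ C) (hz : ‖z‖ ≤ 1)
    (hμ : 0 ≤ μ) (hb : ‖b‖ ≤ β) (hD : ‖D - 1 + b * z‖ ≤ C * (‖z‖ ^ 2 + μ)) (hD1 : ‖D - 1‖ ≤ 1 / 4)
    (hl : ‖l + z * D‖ ≤ ‖z * D‖ ^ 2) :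
    ‖D - 1 - b * l‖ ≤ (C + 2 * β + β * C + β * β) * (‖z‖ ^ 2 + μ) := by
  have hβ : 0 ≤ β := (norm_nonneg b).trans hb
  have hDn : ‖D‖ ≤ 5 / 4 := by
    have := norm_add_le (D - 1) 1
    rw [sub_add_cancel, norm_one] at this
    linarith
  have hDm : ‖D - 1‖ ≤ C * (‖z‖ ^ 2 + μ) + β * ‖z‖ := by
    have h := norm_sub_le (D - 1 + b * z) (b * z)
    rw [add_sub_cancel_right, norm_mul b z] at h
    have := mul_le_mul_of_nonneg_right hb (norm_nonneg z)
    linarith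
  have e : D - 1 - b * l = (D - 1 + b * z) - b * (l + z * D) + b * z * (D - 1) := by ring
  obtain ⟨m, hm⟩ : ∃ m, ‖z‖ = m := ⟨_, rfl⟩
  have hm0 : 0 ≤ m := hm ▸ norm_nonneg z
  rw [hm] at hz hD hDm ⊢
  have t1 : ‖b * (l + z * D)‖ ≤ 2 * β * (m ^ 2 + μ) := by
    have h2 : ‖z * D‖ ^ 2 ≤ (m * (5 / 4)) ^ 2 := by
      rw [norm_mul, hm]; gcongr
    rw [norm_mul]
    calc ‖b‖ * ‖l + z * D‖ ≤ β * ((m * (5 / 4)) ^ 2) := by gcongr; exact hl.trans h2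
      _ ≤ β * (2 * (m ^ 2 + μ)) := by gcongr; nlinarith
      _ = _ := by ring
  have t2 : ‖b * z * (D - 1)‖ ≤ (β * C + β * β) * (m ^ 2 + μ) := by
    rw [norm_mul, norm_mul, hm]
    calc ‖b‖ * m * ‖D - 1‖ ≤ β * m * (C * (m ^ 2 + μ) + β * m) := by gcongr
      _ = β * C * (m * (m ^ 2 + μ)) + β * β * m ^ 2 := by ring
      _ ≤ β * C * (1 * (m ^ 2 + μ)) + β * β * (m ^ 2 + μ) := by gcongr; linarith
      _ = _ := by ring
  rw [e]
  refine (norm_add_le _ _).trans ((add_le_add (norm_sub_le _ _) le_rfl).trans ?_)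
  linarith

theorem exists_stepBound (q : Polynomial ℂ) (h0 : q.coeff 0 = 0) (h1 : q.coeff 1 = 0)
    (h2 : q.coeff 2 = 1) {d : ℝ} (hd0 : 0 ≤ d) (hd : d < 1) : ∃ C ε : ℝ, StepBound q d C ε := by
  obtain ⟨C, ε₀, hC1, hε₀, hε₀1, H⟩ := exists_drift_slope_bound q h0 h1 h2 hd0 hd
  obtain ⟨β, hβ⟩ : ∃ β, β = 1 + ‖q.coeff 3‖ + 2 * (1 - d)⁻¹ := ⟨_, rfl⟩
  have hb : ∀ δ : ℂ, ‖δ‖ ≤ d → ‖logCoeff q δ‖ ≤ β := fun δ hδ => hβ ▸ norm_logCoeff_le q hd hδ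
  have hβ0 : 0 ≤ β := (norm_nonneg _).trans (hb 0 (by simpa using hd0))
  -- The second entry makes the total drift error at most `1/4`; the third gives `C ‖z‖ ≤ (1 - d) /
  -- 2`, which turns the contraction rate `d` of the slope into `(1 + d) / 2`.
  obtain ⟨ε, hε⟩ : ∃ ε, ε = min ε₀ (min (1 / (12 * C + 4 * β)) ((1 - d) / (2 * C))) := ⟨_, rfl⟩
  have hε0 : 0 < ε := by
    rw [hε]
    have : 0 < 1 - d := by linarith
    positivity
  have hεε₀ : ε ≤ ε₀ := hε ▸ min_le_left _ _
  have hεC : ε * (12 * C + 4 * β) ≤ 1 := by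
    rw [← le_div_iff₀ (by linarith), hε]
    exact (min_le_right _ _).trans (min_le_left _ _)
  have hεd : ε * (2 * C) ≤ 1 - d := by
    rw [← le_div_iff₀ (by linarith), hε]
    exact (min_le_right _ _).trans (min_le_right _ _)
  have hε4 : ε ≤ 1 / 4 := by
    nlinarith [mul_nonneg hε0.le hβ0]
  have hstep : ∀ (δ : ℂ) (p : ℂ × ℂ), ‖δ‖ ≤ d → p.1 ≠ 0 → ‖p.1‖ ≤ ε → ‖slope2 δ p‖ ≤ ε →
      ‖1 / p.1 - 1 / (mapF q δ p).1 - 1‖ ≤ 1 / 4 := by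
    intro δ p hδ hp hpε huε
    obtain ⟨-, H2, -⟩ := H δ p hδ hp (hpε.trans hεε₀) (huε.trans hεε₀)
    have h := norm_sub_le (1 / p.1 - 1 / (mapF q δ p).1 - 1 + logCoeff q δ * p.1)
      (logCoeff q δ * p.1)
    rw [add_sub_cancel_right, norm_mul (logCoeff q δ)] at h
    have h3 : ‖logCoeff q δ‖ * ‖p.1‖ ≤ β * ε := by gcongr; exact hb δ hδ
    have h4 : C * (‖p.1‖ ^ 2 + ‖slope2 δ p‖) ≤ C * (ε + ε) := by
      gcongr
      have := norm_nonneg p.1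
      nlinarith
    have h5 : 0 ≤ ε * C := by positivity
    linarith
  have hlog : ∀ (δ : ℂ) (p : ℂ × ℂ) (W W' : ℂ), ‖δ‖ ≤ d → p.1 ≠ 0 → ‖p.1‖ ≤ ε →
      ‖slope2 δ p‖ ≤ ε → 0 < W.re → 0 < W'.re → ‖W‖ = 1 / ‖p.1‖ →
      ‖W' - W‖ = ‖1 / p.1 - 1 / (mapF q δ p).1‖ →
      (W' - W) / W = - (p.1 * (1 / p.1 - 1 / (mapF q δ p).1)) →
      ‖1 / p.1 - 1 / (mapF q δ p).1 - 1 - logCoeff q δ * (Complex.log W' - Complex.log W)‖ ≤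
        (C + 2 * β + β * C + β * β) * (‖p.1‖ ^ 2 + ‖slope2 δ p‖) := by
    intro δ p W W' hδ hp hpε huε hW hW' hWn hWW hq
    have hD1 := hstep δ p hδ hp hpε huε
    obtain ⟨-, H2, -⟩ := H δ p hδ hp (hpε.trans hεε₀) (huε.trans hεε₀)
    refine norm_log_correction_le (by linarith) (by linarith) (norm_nonneg _) (hb δ hδ) H2 hD1 ?_
    have hDn := norm_add_le (1 / p.1 - 1 / (mapF q δ p).1 - 1) 1
    rw [sub_add_cancel, norm_one] at hDn
    have hW4 : 4 ≤ ‖W‖ := by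
      rw [hWn, le_div_iff₀ (norm_pos_iff.2 hp)]; linarith
    have := norm_log_sub_log_sub_le hW hW' (by rw [hWW]; linarith)
    rwa [hq, sub_neg_eq_add, norm_neg] at this
  have hCβ : C ≤ C + 2 * β + β * C + β * β := by
    have := mul_nonneg hβ0 hβ0
    have := mul_nonneg hβ0 (by linarith : 0 ≤ C)
    linarith
  refine ⟨C + 2 * β + β * C + β * β, ε, hd0, hd, hC1.trans hCβ, hε0, hε4, ?_, ?_, ?_, ?_⟩
  · intro δ hδ
    refine (hb δ hδ).trans ?_
    have := mul_nonneg hβ0 hβ0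
    have := mul_nonneg hβ0 (by linarith : 0 ≤ C)
    linarith
  · intro δ p hδ hp hpε huε
    obtain ⟨H1, -, H3⟩ := H δ p hδ hp (hpε.trans hεε₀) (huε.trans hεε₀)
    refine ⟨H1, hstep δ p hδ hp hpε huε, ?_⟩
    have h := norm_add_le (slope2 δ (mapF q δ p) - δ * slope2 δ p) (δ * slope2 δ p)
    rw [sub_add_cancel, norm_mul δ] at h
    have h3 : ‖δ‖ * ‖slope2 δ p‖ ≤ d * ‖slope2 δ p‖ := by gcongr
    have h4 : C * (‖p.1‖ * ‖slope2 δ p‖) ≤ (1 - d) / 2 * ‖slope2 δ p‖ := by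
      rw [← mul_assoc]
      gcongr
      have : C * ‖p.1‖ ≤ C * ε := by gcongr
      linarith
    have h5 : C * ‖p.1‖ ^ 2 ≤ (C + 2 * β + β * C + β * β) * ‖p.1‖ ^ 2 := by gcongr
    linarith
  · intro δ p hδ hp hpε huε hW hW'
    have := hlog δ p (-1 / p.1) (-1 / (mapF q δ p).1) hδ hp hpε huε hW hW' (by simp)
      (by congr 1; ring) (by field_simp; ring)
    convert this using 2
    rw [omegaIn, omegaIn]; ring
  · intro δ p hδ hp hpε huε hW hW'
    have := hlog δ p (1 / p.1) (1 / (mapF q δ p).1) hδ hp hpε huε hW hW' (by simp)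
      (by rw [← norm_neg]; congr 1; ring) (by field_simp; ring)
    convert this using 2
    rw [omegaOut, omegaOut]; ring

/-! ### Uniform convergence and holomorphy of the iterates in the parameter. -/

theorem tendstoUniformlyOn_of_summable_norm_sub {α G : Type*} [NormedAddCommGroup G]
    [CompleteSpace G] {f : ℕ → α → G} {s : ℕ → ℝ} {U : Set α} (hs : Summable s)
    (h : ∀ n, ∀ x ∈ U, ‖f (n + 1) x - f n x‖ ≤ s n) :
    ∃ g : α → G, TendstoUniformlyOn f g atTop U := by
  refine ⟨fun x => ∑' n, (f (n + 1) x - f n x) + f 0 x, ?_⟩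
  have := tendstoUniformlyOn_tsum_nat hs h
  rw [Metric.tendstoUniformlyOn_iff] at this ⊢
  intro η hη
  filter_upwards [this η hη] with n hn x hx
  have := hn x hx
  rw [Finset.sum_range_sub (fun i => f i x)] at this
  rw [dist_eq_norm] at this ⊢
  convert this using 2
  abel

theorem differentiable_mapF_family (q : Polynomial ℂ) :
    Differentiable ℂ (fun s : ℂ × (ℂ × ℂ) => mapF q s.1 s.2) := by
  unfold mapF
  have h : Differentiable ℂ (fun s : ℂ × (ℂ × ℂ) => q.eval (s.2.1 + s.1 * s.2.2)) :=
    q.differentiable.comp (by fun_prop)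
  exact Differentiable.prodMk (by fun_prop) (by fun_prop)

theorem differentiable_iterate_mapF_family (q : Polynomial ℂ) (n : ℕ) :
    Differentiable ℂ (fun s : ℂ × (ℂ × ℂ) => (mapF q s.1)^[n] s.2) := by
  induction n with
  | zero => exact differentiable_snd
  | succ n ih =>
    simp only [Function.iterate_succ', Function.comp_apply]
    exact (differentiable_mapF_family q).comp (differentiable_fst.prodMk ih)

theorem differentiable_iterate_mapF (q : Polynomial ℂ) (δ : ℂ) (n : ℕ) :
    Differentiable ℂ (mapF q δ)^[n] :=
  (differentiable_iterate_mapF_family q n).comp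
    (f := fun p : ℂ × ℂ => (δ, p)) ((differentiable_const δ).prodMk differentiable_id)

theorem differentiableAt_logCoeff (q : Polynomial ℂ) {δ : ℂ} (hδ : ‖δ‖ < 1) :
    DifferentiableAt ℂ (logCoeff q) δ := by
  have := one_sub_ne_zero hδ
  unfold logCoeff
  fun_prop (disch := assumption)

theorem DifferentiableAt.const_div_apply {E : Type*} [NormedAddCommGroup E] [NormedSpace ℂ E]
    {f : E → ℂ} {x : E} (hf : DifferentiableAt ℂ f x) (c : ℂ) (hx : f x ≠ 0) :
    DifferentiableAt ℂ (fun y => c / f y) x := by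
  simp only [div_eq_mul_inv]
  exact (hf.fun_inv hx).const_mul c

/-! ### The attracting petal and its Fatou coordinate. -/

theorem ne_zero_of_inv_re_pos {z : ℂ} (h : 0 < (1 / z).re) : z ≠ 0 := by
  rintro rfl; simp at h

theorem norm_le_inv_of_le_inv_re {z : ℂ} {R : ℝ} (hR : 0 < R) (h : R ≤ (1 / z).re) :
    ‖z‖ ≤ 1 / R := by
  have h1 : R ≤ ‖1 / z‖ := h.trans ((le_abs_self _).trans (Complex.abs_re_le_norm _))
  rw [norm_div, norm_one] at h1
  have hz : 0 < ‖z‖ := norm_pos_iff.2 (ne_zero_of_inv_re_pos (hR.trans_le h))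
  rw [le_div_iff₀ hz] at h1
  rw [le_div_iff₀ hR]
  linarith

theorem ne_zero_of_neg_inv_re_pos {z : ℂ} (h : 0 < (-1 / z).re) : z ≠ 0 := by
  rintro rfl; simp at h

theorem norm_le_inv_of_le_neg_inv_re {z : ℂ} {R : ℝ} (hR : 0 < R) (h : R ≤ (-1 / z).re) :
    ‖z‖ ≤ 1 / R := by
  rw [← norm_neg]
  exact norm_le_inv_of_le_inv_re hR (by rwa [div_neg, ← neg_div])

/-- The attracting petal of `mapF q δ`. -/
def attractingPetal (δ : ℂ) (R ε : ℝ) : Set (ℂ × ℂ) :=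
  {p | R < (-1 / p.1).re ∧ ‖slope2 δ p‖ < ε}

/-- Majorant for the slopes along orbits in the attracting petal. -/
noncomputable def slopeMajorant (d C ε R : ℝ) : ℕ → ℝ
  | 0 => ε
  | n + 1 => (1 + d) / 2 * slopeMajorant d C ε R n + C * (1 / (R + n / 2)) ^ 2

/-- `R` is large enough for the petal `attractingPetal δ R ε` to be forward invariant. -/
structure PetalRadius (d C ε R : ℝ) : Prop where
  one_div_le : 1 / ε ≤ R
  mul_sq_le : C * (1 / R) ^ 2 ≤ (1 - d) / 2 * ε

theorem StepBound.exists_petalRadius {q : Polynomial ℂ} {d C ε : ℝ} (h : StepBound q d C ε) :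
    ∃ R, PetalRadius d C ε R := by
  have hd := h.d_lt_one
  have hC := h.one_le
  have hε := h.eps_pos
  refine ⟨max (1 / ε) (C / ((1 - d) / 2 * ε)), le_max_left _ _, ?_⟩
  have hpos : 0 < (1 - d) / 2 * ε := by have : 0 < 1 - d := by linarith
                                        positivity
  set R := max (1 / ε) (C / ((1 - d) / 2 * ε))
  have h1 : 1 ≤ R := le_trans (by rw [le_div_iff₀ hε]; linarith [h.eps_le]) (le_max_left _ _)
  have h2 : C / ((1 - d) / 2 * ε) ≤ R := le_max_right _ _
  rw [div_le_iff₀ hpos] at h2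
  have h3 : 1 / R ≤ 1 := by rw [div_le_one (by linarith)]; exact h1
  calc C * (1 / R) ^ 2 ≤ C * (1 / R) := by
        gcongr
        nlinarith [show 0 ≤ 1 / R by positivity]
    _ ≤ _ := by rw [mul_one_div, div_le_iff₀ (by linarith)]; linarith

section Attracting

variable {q : Polynomial ℂ} {d C ε R : ℝ} {δ : ℂ} {p : ℂ × ℂ}

theorem PetalRadius.four_le (hR : PetalRadius d C ε R) (h : StepBound q d C ε) : 4 ≤ R := by
  refine le_trans ?_ hR.one_div_le
  rw [le_div_iff₀ h.eps_pos]
  linarith [h.eps_le]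

theorem StepBound.small_of_le_inv_re (h : StepBound q d C ε) (hR : PetalRadius d C ε R) {z : ℂ}
    (hz : R ≤ (-1 / z).re) : z ≠ 0 ∧ ‖z‖ ≤ 1 / R ∧ ‖z‖ ≤ ε := by
  have h4 := hR.four_le h
  have := norm_le_inv_of_le_neg_inv_re (by linarith) hz
  refine ⟨ne_zero_of_neg_inv_re_pos (by linarith), this, this.trans ?_⟩
  rw [one_div_le (by linarith) h.eps_pos]
  exact hR.one_div_le

theorem StepBound.re_add_half_le (h : StepBound q d C ε) (hδ : ‖δ‖ ≤ d) (hp0 : p.1 ≠ 0)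
    (hpε : ‖p.1‖ ≤ ε) (hu : ‖slope2 δ p‖ ≤ ε) :
    (-1 / p.1).re + 1 / 2 ≤ (-1 / (mapF q δ p).1).re := by
  obtain ⟨-, h2, -⟩ := h.step δ p hδ hp0 hpε hu
  have e : (1 / p.1 - 1 / (mapF q δ p).1 - 1).re
      = (-1 / (mapF q δ p).1).re - (-1 / p.1).re - 1 := by
    rw [show 1 / p.1 - 1 / (mapF q δ p).1 - 1 = -1 / (mapF q δ p).1 - -1 / p.1 - 1 by ring,
      Complex.sub_re, Complex.sub_re, Complex.one_re]
  have := (abs_le.1 ((Complex.abs_re_le_norm _).trans h2)).1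
  rw [e] at this
  linarith

/-- The contracted slope is below `(1 + d) / 2 * ε`, and `PetalRadius` leaves the missing `(1 - d) /
2 * ε` for the term in `‖z‖²`. Only `‖z‖ ≤ 1 / R` is required, not membership in the petal, so the
bound also serves orbits that have not yet arrived there. -/
theorem StepBound.slope_step_lt (h : StepBound q d C ε) (hR : PetalRadius d C ε R) (hδ : ‖δ‖ ≤ d)
    (hp0 : p.1 ≠ 0) (hpR : ‖p.1‖ ≤ 1 / R) (hpε : ‖p.1‖ ≤ ε) (hu : ‖slope2 δ p‖ < ε) :
    ‖slope2 δ (mapF q δ p)‖ < ε := by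
  obtain ⟨-, -, h3⟩ := h.step δ p hδ hp0 hpε hu.le
  have hC := h.one_le
  have hd := h.d_nonneg
  have h4 : C * ‖p.1‖ ^ 2 ≤ C * (1 / R) ^ 2 := by gcongr
  have h5 : (1 + d) / 2 * ‖slope2 δ p‖ < (1 + d) / 2 * ε := by gcongr
  have h6 := hR.mul_sq_le
  linarith

theorem StepBound.petal_orbit (h : StepBound q d C ε) (hR : PetalRadius d C ε R) (hδ : ‖δ‖ ≤ d)
    (hp : p ∈ attractingPetal δ R ε) (n : ℕ) :
    (mapF q δ)^[n] p ∈ attractingPetal δ R ε ∧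
      R + n / 2 ≤ (-1 / ((mapF q δ)^[n] p).1).re ∧
      ‖slope2 δ ((mapF q δ)^[n] p)‖ ≤ slopeMajorant d C ε R n := by
  have h4 := hR.four_le h
  induction n with
  | zero => exact ⟨hp, by simpa using hp.1.le, by simpa [slopeMajorant] using hp.2.le⟩
  | succ n ih =>
    rw [Function.iterate_succ_apply']
    obtain ⟨ih1, ih2, ih3⟩ := ih
    generalize (mapF q δ)^[n] p = x at ih1 ih2 ih3
    obtain ⟨hz0, hzR, hzε⟩ := h.small_of_le_inv_re hR ih1.1.le
    have hre := h.re_add_half_le hδ hz0 hzε ih1.2.le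
    obtain ⟨-, -, h3⟩ := h.step δ x hδ hz0 hzε ih1.2.le
    refine ⟨⟨by linarith [ih1.1], h.slope_step_lt hR hδ hz0 hzR hzε ih1.2⟩, ?_, ?_⟩
    · push_cast; linarith
    · rw [slopeMajorant]
      have hd := h.d_nonneg
      have hC := h.one_le
      have : ‖x.1‖ ≤ 1 / (R + n / 2) := norm_le_inv_of_le_neg_inv_re (by positivity) ih2
      exact h3.trans (by gcongr)

theorem summable_sq_inv_add_half (hR : 4 ≤ R) :
    Summable (fun n : ℕ => (1 / (R + n / 2)) ^ 2) := by
  have h1 : Summable (fun n : ℕ => 4 * (1 / ((n + 1 : ℕ) : ℝ) ^ 2)) :=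
    ((summable_nat_add_iff 1).2 (Real.summable_one_div_nat_pow.2 one_lt_two)).mul_left 4
  refine h1.of_nonneg_of_le (fun n => by positivity) fun n => ?_
  rw [div_pow, one_pow, mul_one_div, div_le_div_iff₀ (by positivity) (by positivity)]
  push_cast
  nlinarith [n.cast_nonneg (α := ℝ)]

theorem summable_slopeMajorant (hd0 : 0 ≤ d) (hd : d < 1) (hC : 0 ≤ C) (hε : 0 ≤ ε)
    (hR : 4 ≤ R) : Summable (slopeMajorant d C ε R) := by
  refine summable_of_le_mul_add (r := (1 + d) / 2) (s := fun n => C * (1 / (R + n / 2)) ^ 2)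
    (fun n => ?_) (fun n => by positivity) (by linarith)
    ((summable_sq_inv_add_half hR).mul_left C) fun n => le_of_eq rfl
  induction n with
  | zero => exact hε
  | succ n ih => rw [slopeMajorant]; positivity

/-- The approximate attracting Fatou coordinates. -/
noncomputable def attractingApprox (q : Polynomial ℂ) (n : ℕ) (s : ℂ × (ℂ × ℂ)) : ℂ :=
  omegaIn (logCoeff q s.1) ((mapF q s.1)^[n] s.2).1 - n

/-- This transports convergence from the petal to its preimages under iterates, and with `N = 1` it
yields the Abel equation. -/
theorem attractingApprox_add (q : Polynomial ℂ) (n N : ℕ) (s : ℂ × (ℂ × ℂ)) :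
    attractingApprox q (n + N) s = attractingApprox q n (s.1, (mapF q s.1)^[N] s.2) - N := by
  simp only [attractingApprox, Function.iterate_add_apply]
  push_cast; ring

theorem StepBound.norm_attractingApprox_sub_le (h : StepBound q d C ε) (hR : PetalRadius d C ε R)
    (hδ : ‖δ‖ ≤ d) (hp : p ∈ attractingPetal δ R ε) (n : ℕ) :
    ‖attractingApprox q (n + 1) (δ, p) - attractingApprox q n (δ, p)‖ ≤
      C * ((1 / (R + n / 2)) ^ 2 + slopeMajorant d C ε R n) := by
  have h4 := hR.four_le h
  have hC := h.one_le
  obtain ⟨h1, h2, h3⟩ := h.petal_orbit hR hδ hp n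
  obtain ⟨h1', -, -⟩ := h.petal_orbit hR hδ hp (n + 1)
  obtain ⟨hz0, -, hzε⟩ := h.small_of_le_inv_re hR h1.1.le
  have hz : ‖((mapF q δ)^[n] p).1‖ ≤ 1 / (R + n / 2) :=
    norm_le_inv_of_le_neg_inv_re (by positivity) h2
  simp only [attractingApprox, Function.iterate_succ_apply'] at h1' ⊢
  have := h.step_in δ _ hδ hz0 hzε h1.2.le (by linarith [h1.1]) (by linarith [h1'.1])
  calc _ = ‖omegaIn (logCoeff q δ) (mapF q δ ((mapF q δ)^[n] p)).1 -
      omegaIn (logCoeff q δ) ((mapF q δ)^[n] p).1 - 1‖ := by congr 1; push_cast; ring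
    _ ≤ _ := this.trans (by gcongr)

theorem StepBound.exists_tendstoUniformlyOn_attractingApprox (h : StepBound q d C ε)
    (hR : PetalRadius d C ε R) : ∃ L : ℂ × (ℂ × ℂ) → ℂ,
      TendstoUniformlyOn (attractingApprox q) L atTop
        {s | ‖s.1‖ ≤ d ∧ s.2 ∈ attractingPetal s.1 R ε} := by
  have h4 := hR.four_le h
  have hC := h.one_le
  exact tendstoUniformlyOn_of_summable_norm_sub
    (((summable_sq_inv_add_half h4).add (summable_slopeMajorant h.d_nonneg h.d_lt_one
      (by linarith) h.eps_pos.le h4)).mul_left C)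
    fun n s hs => h.norm_attractingApprox_sub_le hR hs.1 hs.2 n

theorem norm_le_of_slope2 {E : ℝ} (hp : p.1 ≠ 0) (hp1 : ‖p.1‖ ≤ 1) (hu : ‖slope2 δ p‖ ≤ 1)
    (hE : ‖(1 - δ)⁻¹‖ ≤ E) : ‖p‖ ≤ (1 + E) * ‖p.1‖ := by
  have hE0 : 0 ≤ E := (norm_nonneg _).trans hE
  rw [Prod.norm_def]
  refine max_le (by nlinarith [norm_nonneg p.1]) ?_
  have : ‖slope2 δ p - p.1 / (1 - δ)‖ ≤ 1 + E := by
    refine (norm_sub_le _ _).trans (add_le_add hu ?_)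
    rw [div_eq_mul_inv, norm_mul]
    nlinarith [norm_nonneg (1 - δ)⁻¹]
  rw [snd_eq_slope2 (δ := δ) hp, norm_mul, mul_comm]
  gcongr

theorem StepBound.tendstoUniformlyOn_petal (h : StepBound q d C ε) (hR : PetalRadius d C ε R)
    (hδ : ‖δ‖ ≤ d) : TendstoUniformlyOn (fun n : ℕ => (mapF q δ)^[n]) (fun _ => 0) atTop
      (attractingPetal δ R ε) := by
  have h4 := hR.four_le h
  have hε := h.eps_le
  rw [Metric.tendstoUniformlyOn_iff]
  intro η hη
  have hlim : Tendsto (fun n : ℕ => (1 + (1 - d)⁻¹) * (1 / (R + n / 2))) atTop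
      (𝓝 ((1 + (1 - d)⁻¹) * 0)) := by
    refine Tendsto.const_mul _ (tendsto_const_nhds.div_atTop ?_)
    exact tendsto_atTop_add_const_left _ _ (tendsto_natCast_atTop_atTop.atTop_div_const two_pos)
  rw [mul_zero] at hlim
  filter_upwards [hlim.eventually_lt_const hη] with n hn p hp
  obtain ⟨h1, h2, -⟩ := h.petal_orbit hR hδ hp n
  obtain ⟨hz0, -, hzε⟩ := h.small_of_le_inv_re hR h1.1.le
  rw [dist_zero_left]
  refine lt_of_le_of_lt (norm_le_of_slope2 (δ := δ) hz0 (by linarith) (by linarith [h1.2])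
    (norm_inv_one_sub_le h.d_lt_one hδ)) (lt_of_le_of_lt ?_ hn)
  have : 0 < 1 - d := by linarith [h.d_lt_one]
  gcongr
  exact norm_le_inv_of_le_neg_inv_re (by positivity) h2

theorem eventually_mem_attractingPetal {s₀ : ℂ × (ℂ × ℂ)} (hR : 0 ≤ R) (hδ : ‖s₀.1‖ < 1)
    (hs : s₀.2 ∈ attractingPetal s₀.1 R ε) :
    ∀ᶠ s in 𝓝 s₀, s.2 ∈ attractingPetal s.1 R ε := by
  have hz : s₀.2.1 ≠ 0 := ne_zero_of_neg_inv_re_pos (hR.trans_lt hs.1)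
  have hδ' := one_sub_ne_zero hδ
  have c1 : ContinuousAt (fun s : ℂ × (ℂ × ℂ) => (-1 / s.2.1).re) s₀ :=
    Complex.continuous_re.continuousAt.comp (by fun_prop (disch := assumption))
  have c2 : ContinuousAt (fun s : ℂ × (ℂ × ℂ) => ‖slope2 s.1 s.2‖) s₀ := by
    unfold slope2
    fun_prop (disch := assumption)
  exact (c1.eventually (lt_mem_nhds hs.1)).and (c2.eventually (gt_mem_nhds hs.2))

theorem eventually_iterate_mem_attractingPetal {s₀ : ℂ × (ℂ × ℂ)} (hR : 0 ≤ R) (hδ : ‖s₀.1‖ < 1)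
    {N : ℕ} (hs : (mapF q s₀.1)^[N] s₀.2 ∈ attractingPetal s₀.1 R ε) :
    ∀ᶠ s in 𝓝 s₀, (mapF q s.1)^[N] s.2 ∈ attractingPetal s.1 R ε := by
  have hc : ContinuousAt (fun s : ℂ × (ℂ × ℂ) => (s.1, (mapF q s.1)^[N] s.2)) s₀ :=
    (differentiable_fst.prodMk (differentiable_iterate_mapF_family q N)).continuous.continuousAt
  exact hc.eventually (eventually_mem_attractingPetal hR hδ hs)

theorem StepBound.mem_parabolicBasin (h : StepBound q d C ε) (hR : PetalRadius d C ε R)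
    (hδ : ‖δ‖ ≤ d) {N : ℕ} (hp : (mapF q δ)^[N] p ∈ attractingPetal δ R ε) :
    p ∈ parabolicBasin (mapF q δ) := by
  have h4 := hR.four_le h
  have hU := eventually_iterate_mem_attractingPetal (s₀ := (δ, p)) (by linarith)
    (hδ.trans_lt h.d_lt_one) hp
  have hV : ∀ᶠ x in 𝓝 p, (mapF q δ)^[N] x ∈ attractingPetal δ R ε :=
    (Continuous.prodMk_right δ).continuousAt.eventually hU
  refine ⟨_, hV, ?_⟩
  have := h.tendstoUniformlyOn_petal hR hδ
  rw [Metric.tendstoUniformlyOn_iff] at this ⊢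
  intro η hη
  have h2 := (tendsto_sub_atTop_nat N).eventually (this η hη)
  filter_upwards [h2, eventually_ge_atTop N] with n hn hnN x hx
  have := hn _ hx
  rwa [← Function.iterate_add_apply, Nat.sub_add_cancel hnN] at this

/-- The attracting Fatou coordinate of `mapF q δ`. -/
noncomputable def attractingFatou (q : Polynomial ℂ) (δ : ℂ) (p : ℂ × ℂ) : ℂ :=
  limUnder atTop fun n : ℕ => attractingApprox q n (δ, p)

theorem StepBound.tendsto_attractingApprox (h : StepBound q d C ε) (hR : PetalRadius d C ε R)
    (hδ : ‖δ‖ ≤ d) {N : ℕ} (hp : (mapF q δ)^[N] p ∈ attractingPetal δ R ε) :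
    Tendsto (fun n : ℕ => attractingApprox q n (δ, p)) atTop (𝓝 (attractingFatou q δ p)) := by
  obtain ⟨L, hL⟩ := h.exists_tendstoUniformlyOn_attractingApprox hR
  have h1 := (hL.tendsto_at (x := (δ, (mapF q δ)^[N] p)) ⟨hδ, hp⟩).sub_const (N : ℂ)
  have h2 : Tendsto (fun n : ℕ => attractingApprox q n (δ, p)) atTop
      (𝓝 (L (δ, (mapF q δ)^[N] p) - N)) := by
    rw [← tendsto_add_atTop_iff_nat N]
    simpa only [attractingApprox_add] using h1
  exact tendsto_nhds_limUnder ⟨_, h2⟩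

theorem StepBound.differentiableAt_attractingFatou (h : StepBound q d C ε)
    (hR : PetalRadius d C ε R) {s₀ : ℂ × (ℂ × ℂ)} (hδ : ‖s₀.1‖ < d) {N : ℕ}
    (hs : (mapF q s₀.1)^[N] s₀.2 ∈ attractingPetal s₀.1 R ε) :
    DifferentiableAt ℂ (fun s : ℂ × (ℂ × ℂ) => attractingFatou q s.1 s.2) s₀ := by
  have h4 := hR.four_le h
  have hd := h.d_lt_one
  have hU : {s : ℂ × (ℂ × ℂ) | ‖s.1‖ < d ∧
      (mapF q s.1)^[N] s.2 ∈ attractingPetal s.1 R ε} ∈ 𝓝 s₀ :=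
    (continuous_fst.norm.continuousAt.eventually (gt_mem_nhds hδ)).and
      (eventually_iterate_mem_attractingPetal (by linarith) (by linarith) hs)
  refine differentiableAt_of_tendstoUniformlyOn (f := attractingApprox q) hU ?_ ?_
  -- Only from time `N` on is the orbit known to lie in the petal, where the principal logarithm is
  -- holomorphic.
  · filter_upwards [eventually_ge_atTop N] with n hn s hs
    have hmem := (h.petal_orbit hR hs.1.le hs.2 (n - N)).1
    rw [← Function.iterate_add_apply, Nat.sub_add_cancel hn] at hmem
    have hre : 0 < (-1 / ((mapF q s.1)^[n] s.2).1).re := by linarith [hmem.1]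
    have hz := ne_zero_of_neg_inv_re_pos hre
    have hit : DifferentiableAt ℂ (fun s : ℂ × (ℂ × ℂ) => ((mapF q s.1)^[n] s.2).1) s :=
      (differentiable_iterate_mapF_family q n s).fst
    have hb : DifferentiableAt ℂ (fun s : ℂ × (ℂ × ℂ) => logCoeff q s.1) s :=
      (differentiableAt_logCoeff q (by linarith [hs.1])).comp s differentiableAt_fst
    have hinv : DifferentiableAt ℂ (fun s : ℂ × (ℂ × ℂ) => -1 / ((mapF q s.1)^[n] s.2).1) s :=
      hit.const_div_apply (-1) hz
    exact ((hinv.sub (hb.mul (hinv.clog (Or.inl hre)))).sub_const _).differentiableWithinAt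
  · obtain ⟨L, hL⟩ := h.exists_tendstoUniformlyOn_attractingApprox hR
    have key : TendstoUniformlyOn (attractingApprox q)
        (fun s => L (s.1, (mapF q s.1)^[N] s.2) - N) atTop
        {s : ℂ × (ℂ × ℂ) | ‖s.1‖ < d ∧ (mapF q s.1)^[N] s.2 ∈ attractingPetal s.1 R ε} := by
      rw [Metric.tendstoUniformlyOn_iff] at hL ⊢
      intro η hη
      filter_upwards [(tendsto_sub_atTop_nat N).eventually (hL η hη), eventually_ge_atTop N]
        with n hn hnN s hs
      have := hn (s.1, (mapF q s.1)^[N] s.2) ⟨hs.1.le, hs.2⟩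
      have e := attractingApprox_add q (n - N) N s
      rw [Nat.sub_add_cancel hnN] at e
      rwa [e, dist_sub_right]
    refine key.congr_right fun s hs => ?_
    exact tendsto_nhds_unique (key.tendsto_at hs)
      (h.tendsto_attractingApprox hR hs.1.le hs.2)

end Attracting

/-! ### Derivatives on the basin, and the degenerate case `δ = 0`. -/

/-- This is the obstruction used to exclude points from the basin: along any complex line through a
basin point, the derivatives of the iterates must tend to `0`. -/
theorem TendstoUniformlyOn.tendsto_deriv_zero {E : Type*} [NormedAddCommGroup E] [NormedSpace ℂ E]
    [CompleteSpace E] {g : ℕ → ℂ → E} {V : Set ℂ} {x : ℂ} (hV : V ∈ 𝓝 x)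
    (hg : ∀ n, Differentiable ℂ (g n)) (h : TendstoUniformlyOn g (fun _ => 0) atTop V) :
    Tendsto (fun n => deriv (g n) x) atTop (𝓝 0) := by
  have h1 := ((h.mono interior_subset).tendstoLocallyUniformlyOn.deriv
    (Eventually.of_forall fun n => (hg n).differentiableOn) isOpen_interior).tendsto_at
    (mem_interior_iff_mem_nhds.2 hV)
  simpa using h1

theorem exists_quadratic_bound (q : Polynomial ℂ) (h0 : q.coeff 0 = 0) (h1 : q.coeff 1 = 0) :
    ∃ M : ℝ, 1 ≤ M ∧ ∀ w : ℂ, ‖w‖ ≤ 1 → ‖q.eval w‖ ≤ M * ‖w‖ ^ 2 ∧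
      ‖q.derivative.eval w‖ ≤ M * ‖w‖ := by
  have e : ∀ (p : Polynomial ℂ) (w : ℂ), p.eval w = p.divX.eval w * w + p.coeff 0 := fun p w => by
    conv_lhs => rw [← Polynomial.divX_mul_X_add p]
    simp
  obtain ⟨B, hB, hB'⟩ := exists_norm_eval_le q.divX.divX
  obtain ⟨B₁, hB₁, hB₁'⟩ := exists_norm_eval_le q.derivative.divX
  refine ⟨1 + B + B₁, by linarith, fun w hw => ⟨?_, ?_⟩⟩
  · rw [e q, e q.divX]
    simp only [Polynomial.coeff_divX, h0, h1, zero_add, add_zero]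
    rw [mul_assoc, ← sq, norm_mul, norm_pow]
    gcongr
    linarith [hB' w (by linarith)]
  · rw [e q.derivative, Polynomial.coeff_derivative, zero_add, h1, zero_mul, add_zero, norm_mul]
    gcongr
    linarith [hB₁' w (by linarith)]

section OneVariable

theorem differentiable_iterate_mapf (q : Polynomial ℂ) (n : ℕ) :
    Differentiable ℂ (mapf q)^[n] :=
  (differentiable_id.add q.differentiable : Differentiable ℂ (mapf q)).iterate n

theorem hasDerivAt_iterate_mapf_zero {q : Polynomial ℂ} (h0 : q.coeff 0 = 0) (h1 : q.coeff 1 = 0)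
    (n : ℕ) : HasDerivAt (mapf q)^[n] 1 0 := by
  have h : HasDerivAt (mapf q) 1 0 := by
    have := (hasDerivAt_id (0 : ℂ)).add (q.hasDerivAt 0)
    rwa [← Polynomial.coeff_zero_eq_eval_zero, Polynomial.coeff_derivative, zero_add, h1, zero_mul,
      add_zero] at this
  have hfix : mapf q 0 = 0 := by
    rw [mapf, ← Polynomial.coeff_zero_eq_eval_zero, h0, add_zero]
  simpa using h.iterate _ hfix n

/-- No point of the parabolic basin of `f` is mapped onto the fixed point. -/
theorem iterate_mapf_ne_zero {q : Polynomial ℂ} (h0 : q.coeff 0 = 0) (h1 : q.coeff 1 = 0) {z : ℂ}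
    (hz : z ∈ parabolicBasin (mapf q)) (N : ℕ) : (mapf q)^[N] z ≠ 0 := by
  intro hN
  obtain ⟨V, hV, hlim⟩ := hz
  have han : AnalyticOnNhd ℂ (mapf q)^[N] Set.univ :=
    (differentiable_iterate_mapf q N).differentiableOn.analyticOnNhd isOpen_univ
  -- Either the iterate is constant by the identity theorem, contradicting derivative `1` at `0`, or
  -- it is open at `z`. In the latter case a neighbourhood of `0` is the image of one of `z`, so the
  -- iterates converge uniformly near `0`, where their derivatives all equal `1`.
  rcases (han z trivial).eventually_constant_or_nhds_le_map_nhds with hc | ho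
  · have heq : (mapf q)^[N] = fun _ => (mapf q)^[N] z :=
      han.eq_of_eventuallyEq (fun _ _ => analyticAt_const) hc
    have h2 := hasDerivAt_iterate_mapf_zero h0 h1 N
    rw [heq] at h2
    exact one_ne_zero (h2.unique (hasDerivAt_const _ _))
  · rw [hN] at ho
    have hV' : (mapf q)^[N] '' V ∈ 𝓝 (0 : ℂ) := ho (image_mem_map hV)
    have hlim' : TendstoUniformlyOn (fun n : ℕ => (mapf q)^[n]) (fun _ => 0) atTop
        ((mapf q)^[N] '' V) := by
      rw [Metric.tendstoUniformlyOn_iff] at hlim ⊢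
      intro η hη
      have := (tendsto_add_atTop_nat N).eventually (hlim η hη)
      filter_upwards [this] with n hn
      rintro _ ⟨y, hy, rfl⟩
      rw [← Function.iterate_add_apply]
      exact hn y hy
    have h3 := hlim'.tendsto_deriv_zero hV' (differentiable_iterate_mapf q)
    simp only [(hasDerivAt_iterate_mapf_zero h0 h1 _).deriv] at h3
    exact one_ne_zero (tendsto_nhds_unique tendsto_const_nhds h3)

theorem fst_mapF_zero_iterate (q : Polynomial ℂ) (n : ℕ) (p : ℂ × ℂ) :
    ((mapF q 0)^[n] p).1 = (mapf q)^[n] p.1 :=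
  (Function.Semiconj.iterate_right (f := Prod.fst) (ga := mapF q 0) (gb := mapf q)
    (fun p => by simp [mapF, mapf]) n).eq p

theorem parabolicBasin_mapF_zero (q : Polynomial ℂ) :
    parabolicBasin (mapF q 0) = {p | p.1 ∈ parabolicBasin (mapf q)} := by
  ext p
  constructor
  · rintro ⟨V, hV, hlim⟩
    refine ⟨(fun z => (z, p.2)) ⁻¹' V, (Continuous.prodMk_left p.2).continuousAt.preimage_mem_nhds
      hV, ?_⟩
    rw [Metric.tendstoUniformlyOn_iff] at hlim ⊢
    intro η hη
    filter_upwards [hlim η hη] with n hn z hz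
    have := hn _ hz
    rw [dist_zero_left] at this ⊢
    rw [← fst_mapF_zero_iterate q n (z, p.2)]
    exact (norm_fst_le _).trans_lt this
  · rintro ⟨V, hV, hlim⟩
    refine ⟨Prod.fst ⁻¹' V, continuous_fst.continuousAt.preimage_mem_nhds hV, ?_⟩
    rw [Metric.tendstoUniformlyOn_iff] at hlim ⊢
    intro η hη
    have h1 := hlim (η / 2) (by positivity)
    have h2 := (tendsto_sub_atTop_nat 1).eventually h1
    filter_upwards [h1, h2, eventually_ge_atTop 1] with n hn hn1 hge y hy
    have a1 := hn _ hy
    have a2 := hn1 _ hy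
    rw [dist_zero_left] at a1 a2 ⊢
    obtain ⟨k, rfl⟩ := Nat.exists_eq_add_of_le' hge
    rw [Nat.add_sub_cancel] at a2
    -- At `δ = 0` the new second coordinate is `-q(z) = z - f(z)`, so it tends to `0` along with the
    -- orbit of `z`.
    have e2 : ((mapF q 0)^[k + 1] y).2 = (mapf q)^[k] y.1 - (mapf q)^[k + 1] y.1 := by
      rw [Function.iterate_succ_apply', Function.iterate_succ_apply', ← fst_mapF_zero_iterate]
      simp [mapF, mapf]
    rw [Prod.norm_def, fst_mapF_zero_iterate, e2]
    refine max_lt (by linarith) ((norm_sub_le _ _).trans_lt (by linarith))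

end OneVariable

/-! ### Every basin orbit enters the attracting petal. -/

section Stable

variable {q : Polynomial ℂ} {d : ℝ} {δ : ℂ}

/-- For `δ ≠ 0` the map is an automorphism: the sum of the coordinates of the image is `z + δ x`,
from which both coordinates can be recovered. The neighbourhood is carried along by pulling it back
under the inverse. -/
theorem iterate_mem_parabolicBasin_of_ne_zero (hδ0 : δ ≠ 0) {p : ℂ × ℂ}
    (hp : p ∈ parabolicBasin (mapF q δ)) (N : ℕ) :
    (mapF q δ)^[N] p ∈ parabolicBasin (mapF q δ) := by
  obtain ⟨V, hV, hlim⟩ := hp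
  let G : ℂ × ℂ → ℂ × ℂ := fun y =>
    (y.1 - q.eval (y.1 + y.2), (y.2 + q.eval (y.1 + y.2)) / δ)
  have hG : Continuous G := by
    have : Continuous fun y : ℂ × ℂ => q.eval (y.1 + y.2) := q.continuous.comp (by fun_prop)
    exact Continuous.prodMk (by fun_prop) (by fun_prop)
  have hGF : Function.LeftInverse G (mapF q δ) := fun x => by
    have e : x.1 + q.eval (x.1 + δ * x.2) + (δ * x.2 - q.eval (x.1 + δ * x.2))
        = x.1 + δ * x.2 := by ring
    simp only [G, mapF, e]
    ext
    · simp
    · simp only; field_simp; ring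
  have hFG : Function.LeftInverse (mapF q δ) G := fun y => by
    have e : y.1 - q.eval (y.1 + y.2) + δ * ((y.2 + q.eval (y.1 + y.2)) / δ) = y.1 + y.2 := by
      field_simp; ring
    simp only [mapF, G, e]
    ext
    · simp
    · simp only; field_simp; ring
  refine ⟨G^[N] ⁻¹' V, (hG.iterate N).continuousAt.preimage_mem_nhds ?_, ?_⟩
  · rwa [hGF.iterate N p]
  · rw [Metric.tendstoUniformlyOn_iff] at hlim ⊢
    intro η hη
    filter_upwards [(tendsto_add_atTop_nat N).eventually (hlim η hη)] with n hn y hy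
    have := hn _ hy
    rwa [Function.iterate_add_apply, hFG.iterate N y] at this

theorem hasDerivAt_mapF_comp {c : ℂ → ℂ × ℂ} {v : ℂ × ℂ} {s : ℂ} (hc : HasDerivAt c v s) :
    HasDerivAt (fun t => mapF q δ (c t))
      (v.1 + q.derivative.eval ((c s).1 + δ * (c s).2) * (v.1 + δ * v.2),
        δ * v.2 - q.derivative.eval ((c s).1 + δ * (c s).2) * (v.1 + δ * v.2)) s := by
  have h1 : HasDerivAt (fun t => (c t).1) v.1 s :=
    (hasFDerivAt_fst (𝕜 := ℂ) (p := c s)).comp_hasDerivAt s hc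
  have h2 : HasDerivAt (fun t => (c t).2) v.2 s :=
    (hasFDerivAt_snd (𝕜 := ℂ) (p := c s)).comp_hasDerivAt s hc
  have hw := h1.fun_add (h2.const_mul δ)
  have hq := (q.hasDerivAt ((c s).1 + δ * (c s).2)).comp s hw
  exact (h1.fun_add hq).prodMk ((h2.const_mul δ).fun_sub hq)

/-- Along an orbit whose displacements `z + δ x` are summable (with small sum), horizontal vectors
are not contracted to zero. -/
theorem not_mem_parabolicBasin_of_sum_le (hd : d < 1) (hδ : ‖δ‖ ≤ d) {P : ℂ × ℂ} {κ : ℕ → ℝ}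
    (hκ : ∀ n, ‖q.derivative.eval (((mapF q δ)^[n] P).1 + δ * ((mapF q δ)^[n] P).2)‖ ≤ κ n)
    (hκd : ∀ n, κ n ≤ (1 - d) / 4) (hsum : ∀ n, ∑ i ∈ Finset.range n, κ i ≤ 1 / 4) :
    P ∉ parabolicBasin (mapF q δ) := by
  rintro ⟨V, hV, hlim⟩
  have hκ0 : ∀ n, 0 ≤ κ n := fun n => (norm_nonneg _).trans (hκ n)
  -- The cone `‖v.2‖ ≤ ‖v.1‖` is preserved because `d + 2 κ ≤ 1 - 2 κ`, and each step shrinks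
  -- `‖v.1‖` by a factor no smaller than `1 - 2 κ n`. The total loss is at most one half.
  have key : ∀ n : ℕ, ∃ v : ℂ × ℂ, HasDerivAt (fun s : ℂ => (mapF q δ)^[n] (P + (s, 0))) v 0 ∧
      ‖v.2‖ ≤ ‖v.1‖ ∧ 1 - 2 * ∑ i ∈ Finset.range n, κ i ≤ ‖v.1‖ := by
    intro n
    induction n with
    | zero =>
      refine ⟨(1, 0), ?_, by simp, by simp⟩
      exact ((hasDerivAt_id (0 : ℂ)).prodMk (hasDerivAt_const _ _)).const_add P
    | succ n ih =>
      obtain ⟨v, hv, hv2, hv1⟩ := ih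
      have hd' := hasDerivAt_mapF_comp (q := q) (δ := δ) hv
      have e : P + ((0 : ℂ), (0 : ℂ)) = P := by rw [← Prod.zero_eq_mk, add_zero]
      rw [e] at hd'
      have hk := hκ n
      generalize q.derivative.eval (((mapF q δ)^[n] P).1 + δ * ((mapF q δ)^[n] P).2) = k at hd' hk
      simp only [Function.iterate_succ_apply']
      refine ⟨_, hd', ?_⟩
      have ht : ‖δ * v.2‖ ≤ d * ‖v.1‖ := by rw [norm_mul]; gcongr; exact (norm_nonneg δ).trans hδ
      have hkt : ‖k * (v.1 + δ * v.2)‖ ≤ κ n * (2 * ‖v.1‖) := by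
        rw [norm_mul]
        gcongr
        · exact hκ0 n
        · refine (norm_add_le _ _).trans ?_
          nlinarith [norm_nonneg v.1]
      have h1 := norm_sub_le (v.1 + k * (v.1 + δ * v.2)) (k * (v.1 + δ * v.2))
      rw [add_sub_cancel_right] at h1
      have h2 := norm_sub_le (δ * v.2) (k * (v.1 + δ * v.2))
      have h3 : κ n * ‖v.1‖ ≤ (1 - d) / 4 * ‖v.1‖ := by gcongr; exact hκd n
      simp only
      refine ⟨by linarith, ?_⟩
      rw [Finset.sum_range_succ]
      have h4 : 1 - 2 * ∑ i ∈ Finset.range n, κ i ≤ 1 := by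
        linarith [Finset.sum_nonneg fun i (_ : i ∈ Finset.range n) => hκ0 i]
      have h5 : κ n ≤ 1 / 4 := by linarith [hκd n, (norm_nonneg δ).trans hδ]
      have h6 : (1 - 2 * ∑ i ∈ Finset.range n, κ i) * (1 - 2 * κ n) ≤ ‖v.1‖ * (1 - 2 * κ n) := by
        gcongr; linarith
      have h7 := mul_le_mul_of_nonneg_left h4 (hκ0 n)
      linarith
  have hc : ContinuousAt (fun s : ℂ => P + (s, (0 : ℂ))) 0 := by fun_prop
  have hV' : (fun s : ℂ => P + (s, (0 : ℂ))) ⁻¹' V ∈ 𝓝 (0 : ℂ) := by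
    refine hc.preimage_mem_nhds ?_
    rwa [← Prod.zero_eq_mk, add_zero]
  have hlim' : TendstoUniformlyOn (fun (n : ℕ) (s : ℂ) => (mapF q δ)^[n] (P + (s, 0)))
      (fun _ => 0) atTop ((fun s : ℂ => P + (s, (0 : ℂ))) ⁻¹' V) :=
    hlim.comp (fun s : ℂ => P + (s, (0 : ℂ)))
  have h0 := hlim'.tendsto_deriv_zero hV' fun n =>
    (differentiable_iterate_mapF q δ n).comp (by fun_prop)
  obtain ⟨n, hn⟩ := (h0.norm.eventually (gt_mem_nhds (by simp : ‖(0 : ℂ × ℂ)‖ < 1 / 2))).exists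
  obtain ⟨v, hv, -, hv1⟩ := key n
  have hn' : ‖deriv (fun s : ℂ => (mapF q δ)^[n] (P + (s, 0))) 0‖ < 1 / 2 := hn
  rw [hv.deriv] at hn'
  linarith [norm_fst_le v, hsum n]

theorem tendsto_zero_of_mem_parabolicBasin {E : Type*} [NormedAddCommGroup E] {T : E → E} {p : E}
    (hp : p ∈ parabolicBasin T) : Tendsto (fun n : ℕ => T^[n] p) atTop (𝓝 0) := by
  obtain ⟨V, hV, hlim⟩ := hp
  exact hlim.tendsto_at (mem_of_mem_nhds hV)

/-- Every orbit in the basin enters each horizontal cone. -/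
theorem frequently_mem_cone (h0 : q.coeff 0 = 0) (h1 : q.coeff 1 = 0) (hδ : ‖δ‖ < 1)
    {p : ℂ × ℂ} (hp : p ∈ parabolicBasin (mapF q δ)) {c : ℝ} (hc : 0 < c) (N₀ : ℕ) :
    ∃ n ≥ N₀, ‖((mapF q δ)^[n] p).2‖ < c * ‖((mapF q δ)^[n] p).1‖ := by
  by_contra! hcon
  obtain ⟨M, hM1, hM⟩ := exists_quadratic_bound q h0 h1
  have hlim := tendsto_zero_of_mem_parabolicBasin hp
  -- Outside the cone `‖z‖ ≤ ‖x‖ / c`, so the whole point is controlled by `x`.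
  obtain ⟨K, hK⟩ : ∃ K, K = 1 + 1 / c := ⟨_, rfl⟩
  have hK1 : 1 ≤ K := by rw [hK]; have : 0 < 1 / c := by positivity
                         linarith
  have hcone : ∀ n ≥ N₀, ‖((mapF q δ)^[n] p).1‖ + ‖((mapF q δ)^[n] p).2‖ ≤
      K * ‖((mapF q δ)^[n] p).2‖ := by
    intro n hn
    have := hcon n hn
    rw [mul_comm, ← le_div_iff₀ hc] at this
    rw [hK]
    have e : (1 + 1 / c) * ‖((mapF q δ)^[n] p).2‖ =
      ‖((mapF q δ)^[n] p).2‖ + ‖((mapF q δ)^[n] p).2‖ / c := by ring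
    rw [e]
    linarith
  -- For `δ = 0` the map is not invertible, but the new `x` is `-q(z) = O(z²)` while the new `z` is
  -- comparable to `z ≠ 0`. Hence the very next point lies in the cone.
  by_cases hδ0 : δ = 0
  · subst hδ0
    have hpf : p.1 ∈ parabolicBasin (mapf q) := by
      have := parabolicBasin_mapF_zero q ▸ hp
      exact this
    have hev := (hlim.norm.eventually (gt_mem_nhds (show ‖(0 : ℂ × ℂ)‖ < 1 / (2 * (K * M)) by
      rw [norm_zero]; positivity)))
    obtain ⟨n, hn, hnN⟩ := (hev.and (eventually_ge_atTop N₀)).exists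
    have hne := iterate_mapf_ne_zero h0 h1 hpf n
    rw [← fst_mapF_zero_iterate] at hne
    have h3 := hcone (n + 1) (by omega)
    rw [Function.iterate_succ_apply'] at h3
    generalize (mapF q 0)^[n] p = x at hn hne h3
    simp only [mapF, zero_mul, add_zero, zero_sub, norm_neg] at h3
    have hx1 : ‖x.1‖ < 1 / (2 * (K * M)) := (norm_fst_le x).trans_lt hn
    rw [lt_div_iff₀ (by positivity)] at hx1
    have hpos : 0 < ‖x.1‖ := norm_pos_iff.2 hne
    have hKM : 1 ≤ K * M := one_le_mul_of_one_le_of_one_le hK1 hM1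
    have hq := (hM x.1 (by nlinarith)).1
    have h4 := norm_sub_le (x.1 + q.eval x.1) (q.eval x.1)
    rw [add_sub_cancel_right] at h4
    have h5 : K * ‖q.eval x.1‖ ≤ K * (M * ‖x.1‖ ^ 2) := by gcongr
    nlinarith
  · obtain ⟨d, hd⟩ : ∃ d, ‖δ‖ = d := ⟨_, rfl⟩
    have hd0 : 0 ≤ d := hd ▸ norm_nonneg δ
    have hd1 : d < 1 := hd ▸ hδ
    have hpos : 0 < 1 - d := by linarith
    -- This smallness gives `K² M ‖x‖ ≤ (1 - d) / 8`. It makes `‖x‖` contract by `(1 + d) / 2`, and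
    -- bounds the sum of `‖q'‖` along the orbit by `(1 - d) / 8 * (2 / (1 - d)) = 1 / 4`.
    have hev := (hlim.norm.eventually (gt_mem_nhds
      (show ‖(0 : ℂ × ℂ)‖ < (1 - d) / (8 * (K * K * M)) by rw [norm_zero]; positivity)))
    obtain ⟨N, hN⟩ := eventually_atTop.1 (hev.and (eventually_ge_atTop N₀))
    have hKK : 1 ≤ K * K := one_le_mul_of_one_le_of_one_le hK1 hK1
    have hKKM : 1 ≤ K * K * M := one_le_mul_of_one_le_of_one_le hKK hM1
    have hMK : M * K ≤ K * K * M := by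
      nlinarith [mul_nonneg (mul_nonneg (by linarith : 0 ≤ M) (by linarith : 0 ≤ K))
        (by linarith : 0 ≤ K - 1)]
    have hw : ∀ n ≥ N, ‖((mapF q δ)^[n] p).1 + δ * ((mapF q δ)^[n] p).2‖ ≤
        K * ‖((mapF q δ)^[n] p).2‖ := by
      intro n hn
      refine le_trans ((norm_add_le _ _).trans ?_) (hcone n (hN n hn).2)
      rw [norm_mul]
      gcongr
      exact mul_le_of_le_one_left (norm_nonneg _) hδ.le
    have hxs : ∀ n ≥ N, ‖((mapF q δ)^[n] p).2‖ * (8 * (K * K * M)) ≤ 1 - d := by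
      intro n hn
      have := ((norm_snd_le _).trans_lt (hN n hn).1).le
      rwa [le_div_iff₀ (by positivity)] at this
    have hw1 : ∀ n ≥ N, K * ‖((mapF q δ)^[n] p).2‖ ≤ 1 := by
      intro n hn
      have h3 := hxs n hn
      have h4 : K ≤ K * K * M := by
        calc K = K * 1 := (mul_one K).symm
          _ ≤ K * (K * M) := by
            gcongr; exact one_le_mul_of_one_le_of_one_le hK1 hM1
          _ = _ := by ring
      have h5 := mul_le_mul_of_nonneg_right h4 (norm_nonneg ((mapF q δ)^[n] p).2)
      linarith
    have hdecay : ∀ k, ‖((mapF q δ)^[k] ((mapF q δ)^[N] p)).2‖ ≤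
        ((1 + d) / 2) ^ k * ‖((mapF q δ)^[N] p).2‖ := by
      intro k
      induction k with
      | zero => simp
      | succ k ih =>
        rw [Function.iterate_succ_apply', pow_succ']
        have hw' := hw (k + N) (by omega)
        have hxs' := hxs (k + N) (by omega)
        have hw1' := hw1 (k + N) (by omega)
        rw [Function.iterate_add_apply] at hw' hxs' hw1'
        generalize (mapF q δ)^[k] ((mapF q δ)^[N] p) = x at ih hw' hxs' hw1'
        have hq := (hM _ (hw'.trans hw1')).1
        have h3 : ‖(mapF q δ x).2‖ ≤ d * ‖x.2‖ + M * (K * ‖x.2‖) ^ 2 := by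
          refine (norm_sub_le _ _).trans ?_
          rw [norm_mul, hd]
          gcongr
          exact hq.trans (by gcongr)
        have h4 : M * (K * ‖x.2‖) ^ 2 ≤ (1 - d) / 2 * ‖x.2‖ := by
          have : M * (K * ‖x.2‖) ^ 2 = (‖x.2‖ * (K * K * M)) * ‖x.2‖ := by ring
          rw [this]
          gcongr
          linarith
        calc _ ≤ (1 + d) / 2 * ‖x.2‖ := by linarith
          _ ≤ _ := by rw [mul_assoc]; gcongr
    refine not_mem_parabolicBasin_of_sum_le (q := q) hd1 hd.le (P := (mapF q δ)^[N] p)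
      (κ := fun k => M * K * ‖((mapF q δ)^[N] p).2‖ * ((1 + d) / 2) ^ k) ?_ ?_ ?_
      (iterate_mem_parabolicBasin_of_ne_zero hδ0 hp N)
    · intro k
      have hw' := hw (k + N) (by omega)
      have hw1' := hw1 (k + N) (by omega)
      rw [Function.iterate_add_apply] at hw' hw1'
      refine (hM _ (hw'.trans hw1')).2.trans ?_
      calc _ ≤ M * (K * (((1 + d) / 2) ^ k * ‖((mapF q δ)^[N] p).2‖)) := by
            gcongr; exact hw'.trans (by gcongr; exact hdecay k)
        _ = _ := by ring
    · intro k
      have h3 : ((1 + d) / 2) ^ k ≤ 1 := pow_le_one₀ (by linarith) (by linarith)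
      have h4 := hxs N le_rfl
      have h5 : M * K * ‖((mapF q δ)^[N] p).2‖ ≤ K * K * M * ‖((mapF q δ)^[N] p).2‖ :=
        mul_le_mul_of_nonneg_right hMK (norm_nonneg _)
      calc _ ≤ M * K * ‖((mapF q δ)^[N] p).2‖ * 1 := by gcongr
        _ ≤ _ := by linarith
    · intro n
      rw [← Finset.mul_sum]
      have h3 : ∑ i ∈ Finset.range n, ((1 + d) / 2) ^ i ≤ 2 / (1 - d) := by
        rw [geom_sum_eq (by linarith), le_div_iff₀ hpos]
        have h6 : ((1 + d) / 2) ^ n ≥ 0 := by positivity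
        have h7 : (1 + d) / 2 - 1 = - ((1 - d) / 2) := by ring
        rw [h7, div_neg, neg_mul, ← mul_neg, div_mul_eq_mul_div, div_le_iff₀ (by positivity)]
        nlinarith
      have h4 := hxs N le_rfl
      have h5 : M * K * ‖((mapF q δ)^[N] p).2‖ ≤ K * K * M * ‖((mapF q δ)^[N] p).2‖ :=
        mul_le_mul_of_nonneg_right hMK (norm_nonneg _)
      have h6 : M * K * ‖((mapF q δ)^[N] p).2‖ ≤ (1 - d) / 8 := by linarith
      calc _ ≤ (1 - d) / 8 * (2 / (1 - d)) := by gcongr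
        _ = 1 / 4 := by field_simp; norm_num

/-- Convergence to `0` makes `‖z‖ < 1 / R` at all late times. Once the orbit meets a narrow cone at
such a time, its slope is below `ε` and remains so; then `Re (-1/z)` gains at least `1/2` per step,
whatever its initial value, and eventually exceeds `R`. -/
theorem StepBound.exists_iterate_mem_attractingPetal {C ε R : ℝ} (h : StepBound q d C ε)
    (hR : PetalRadius d C ε R) (h0 : q.coeff 0 = 0) (h1 : q.coeff 1 = 0) (hδ : ‖δ‖ ≤ d)
    {p : ℂ × ℂ} (hp : p ∈ parabolicBasin (mapF q δ)) :
    ∃ N, (mapF q δ)^[N] p ∈ attractingPetal δ R ε := by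
  have h4 := hR.four_le h
  have hd := h.d_lt_one
  have hε := h.eps_pos
  have hpos : 0 < 1 - d := by linarith
  have hRε : 1 / R ≤ ε := by
    rw [one_div_le (by linarith) hε]; exact hR.one_div_le
  have hev := (tendsto_zero_of_mem_parabolicBasin hp).norm.eventually (gt_mem_nhds
    (show ‖(0 : ℂ × ℂ)‖ < min (1 / R) (ε / 2 * (1 - d)) by rw [norm_zero]; positivity))
  obtain ⟨N, hN⟩ := eventually_atTop.1 hev
  have hsmall : ∀ n ≥ N, ‖((mapF q δ)^[n] p).1‖ < min (1 / R) (ε / 2 * (1 - d)) :=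
    fun n hn => (norm_fst_le _).trans_lt (hN n hn)
  obtain ⟨n, hnN, hn⟩ := frequently_mem_cone h0 h1 (hδ.trans_lt hd) hp (half_pos hε) N
  have hz0 : ((mapF q δ)^[n] p).1 ≠ 0 := by
    intro h3
    rw [h3, norm_zero, mul_zero] at hn
    exact (norm_nonneg _).not_gt hn
  have key : ∀ k : ℕ, ((mapF q δ)^[k + n] p).1 ≠ 0 ∧ ‖slope2 δ ((mapF q δ)^[k + n] p)‖ < ε ∧
      (-1 / ((mapF q δ)^[n] p).1).re + k / 2 ≤ (-1 / ((mapF q δ)^[k + n] p).1).re := by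
    intro k
    induction k with
    | zero =>
      rw [zero_add]
      refine ⟨hz0, ?_, by simp⟩
      have hs := (hsmall n hnN).trans_le (min_le_right _ _)
      generalize (mapF q δ)^[n] p = x at hn hz0 hs
      have hx0 : 0 < ‖x.1‖ := norm_pos_iff.2 hz0
      rw [slope2]
      refine (norm_add_le _ _).trans_lt ?_
      have t1 : ‖x.2 / x.1‖ < ε / 2 := by rwa [norm_div, div_lt_iff₀ hx0]
      have t2 : ‖x.1 / (1 - δ)‖ ≤ ε / 2 := by
        rw [div_eq_mul_inv, norm_mul]
        calc _ ≤ (ε / 2 * (1 - d)) * (1 - d)⁻¹ := by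
              gcongr; exact norm_inv_one_sub_le hd hδ
          _ = ε / 2 := by field_simp
      linarith
    | succ k ih =>
      obtain ⟨ih1, ih2, ih3⟩ := ih
      have hs := (hsmall (k + n) (by omega)).trans_le (min_le_left _ _)
      rw [show k + 1 + n = (k + n) + 1 by ring, Function.iterate_succ_apply']
      generalize (mapF q δ)^[k + n] p = x at ih1 ih2 ih3 hs
      have hre := h.re_add_half_le hδ ih1 (hs.le.trans hRε) ih2.le
      refine ⟨(h.step δ x hδ ih1 (hs.le.trans hRε) ih2.le).1,
        h.slope_step_lt hR hδ ih1 hs.le (hs.le.trans hRε) ih2, ?_⟩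
      push_cast; linarith
  obtain ⟨k, hk⟩ := exists_nat_gt (2 * (R - (-1 / ((mapF q δ)^[n] p).1).re))
  obtain ⟨-, k2, k3⟩ := key k
  exact ⟨k + n, by linarith, k2⟩

end Stable

/-! ### The outgoing coordinate and its inverse. -/

theorem omegaOut_eq (b z : ℂ) : omegaOut b z = -(1 / z + b * Complex.log (1 / z)) := by
  rw [omegaOut]; ring

/-- The real part of `1 / z` is controlled by the outgoing coordinate. -/
theorem exists_half_le_inv_re (β M : ℝ) : ∃ K : ℝ, ∀ b z : ℂ, ‖b‖ ≤ β → 1 ≤ (1 / z).re →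
    |(omegaOut b z).im| ≤ M → K ≤ -(omegaOut b z).re → -(omegaOut b z).re / 2 ≤ (1 / z).re := by
  obtain ⟨C, hC, H⟩ := exists_norm_mul_log_le β
  refine ⟨max 0 (3 * (M + 2 * C)), fun b z hb hz him hre => ?_⟩
  have hl := H b (1 / z) hb hz
  rw [omegaOut_eq] at him hre ⊢
  generalize 1 / z = W at *
  obtain ⟨Y, hY⟩ : ∃ Y, Y = W + b * Complex.log W := ⟨_, rfl⟩
  rw [← hY, Complex.neg_re, neg_neg] at hre ⊢
  rw [← hY, Complex.neg_im, abs_neg] at him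
  have hW : W = Y - b * Complex.log W := by rw [hY]; ring
  have h1 : ‖W‖ ≤ ‖Y‖ + (‖W‖ / 8 + C) := by
    have := norm_sub_le Y (b * Complex.log W)
    rw [← hW] at this
    linarith
  have h0 : 0 ≤ Y.re := (le_max_left _ _).trans hre
  have h2 : ‖Y‖ ≤ Y.re + M := by
    have := Complex.norm_le_abs_re_add_abs_im Y
    rw [abs_of_nonneg h0] at this
    linarith
  have h3 : Y.re - W.re ≤ ‖W‖ / 8 + C := by
    have : Y.re - W.re = (b * Complex.log W).re := by
      rw [← Complex.sub_re, hY, add_sub_cancel_left]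
    rw [this]
    exact ((le_abs_self _).trans (Complex.abs_re_le_norm _)).trans hl
  have h4 := (le_max_right _ _).trans hre
  linarith [(abs_nonneg _).trans him]

/-- On `Re ≥ m ≥ 2 ‖b‖` the term `b log` is `1/2`-Lipschitz, so `W + b log W` is bi-Lipschitz; this
compares distances in `1 / z` with distances in the outgoing coordinate. -/
theorem norm_omega_sub_sub_le {b W W' : ℂ} {m : ℝ} (hm : 0 < m) (hb : ‖b‖ ≤ m / 2) (hW : m ≤ W.re)
    (hW' : m ≤ W'.re) :
    ‖(W' + b * Complex.log W') - (W + b * Complex.log W) - (W' - W)‖ ≤ ‖W' - W‖ / 2 := by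
  have e : (W' + b * Complex.log W') - (W + b * Complex.log W) - (W' - W)
      = b * (Complex.log W' - Complex.log W) := by ring
  rw [e, norm_mul]
  calc ‖b‖ * ‖Complex.log W' - Complex.log W‖ ≤ m / 2 * (m⁻¹ * ‖W' - W‖) := by
        gcongr; exact norm_log_sub_log_le hm hW hW'
    _ = _ := by field_simp

theorem norm_inv_sub_inv_le {b z z' : ℂ} {m : ℝ} (hm : 0 < m) (hb : ‖b‖ ≤ m / 2)
    (hz : m ≤ (1 / z).re) (hz' : m ≤ (1 / z').re) :
    ‖1 / z' - 1 / z‖ ≤ 2 * ‖omegaOut b z' - omegaOut b z‖ := by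
  have h := norm_omega_sub_sub_le hm hb hz hz'
  have h2 := norm_sub_le ((1 / z' + b * Complex.log (1 / z')) - (1 / z + b * Complex.log (1 / z)))
    ((1 / z' + b * Complex.log (1 / z')) - (1 / z + b * Complex.log (1 / z)) - (1 / z' - 1 / z))
  rw [sub_sub_cancel] at h2
  have e : ‖omegaOut b z' - omegaOut b z‖ =
      ‖(1 / z' + b * Complex.log (1 / z')) - (1 / z + b * Complex.log (1 / z))‖ := by
    rw [← norm_neg, omegaOut_eq, omegaOut_eq]; congr 1; ring
  rw [e]
  linarith

theorem norm_omegaOut_sub_le {b z z' : ℂ} {m : ℝ} (hm : 0 < m) (hb : ‖b‖ ≤ m / 2)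
    (hz : m ≤ (1 / z).re) (hz' : m ≤ (1 / z').re) :
    ‖omegaOut b z' - omegaOut b z‖ ≤ 2 * ‖1 / z' - 1 / z‖ := by
  have h := norm_omega_sub_sub_le hm hb hz hz'
  have h2 := norm_add_le ((1 / z' + b * Complex.log (1 / z')) - (1 / z + b * Complex.log (1 / z))
    - (1 / z' - 1 / z)) (1 / z' - 1 / z)
  rw [sub_add_cancel] at h2
  have e : ‖omegaOut b z' - omegaOut b z‖ =
      ‖(1 / z' + b * Complex.log (1 / z')) - (1 / z + b * Complex.log (1 / z))‖ := by
    rw [← norm_neg, omegaOut_eq, omegaOut_eq]; congr 1; ring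
  rw [e]
  linarith [norm_nonneg (1 / z' - 1 / z)]

/-- On a half-plane `Re ≥ m > ‖b‖` the map `b log` is a strict contraction, so adding it to the
identity keeps injectivity. -/
theorem injOn_omegaOut (b : ℂ) : Set.InjOn (omegaOut b) (outPetal b) := by
  intro z hz z' hz' h
  rw [outPetal, Set.mem_ofPred_eq] at hz hz'
  rw [omegaOut_eq, omegaOut_eq, neg_inj] at h
  set m := min (1 / z).re (1 / z').re
  have hbm : ‖b‖ < m := lt_min hz hz'
  have hm : 0 < m := (norm_nonneg b).trans_lt hbm
  have h1 := norm_log_sub_log_le hm (min_le_left _ _ : m ≤ (1 / z).re)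
    (min_le_right _ _ : m ≤ (1 / z').re)
  have h2 : 1 / z' - 1 / z = -(b * (Complex.log (1 / z') - Complex.log (1 / z))) := by
    linear_combination -h
  have h3 : ‖1 / z' - 1 / z‖ ≤ ‖b‖ * (m⁻¹ * ‖1 / z' - 1 / z‖) := by
    conv_lhs => rw [h2, norm_neg, norm_mul]
    gcongr
  have h4 : ‖b‖ * m⁻¹ < 1 := by rwa [← div_eq_mul_inv, div_lt_one hm]
  have h5 : ‖1 / z' - 1 / z‖ = 0 := by
    by_contra hne
    have : 0 < ‖1 / z' - 1 / z‖ := lt_of_le_of_ne (norm_nonneg _) (Ne.symm hne)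
    nlinarith
  rw [norm_eq_zero, sub_eq_zero, one_div, one_div, inv_inj] at h5
  exact h5.symm

theorem omegaOutInv_eq {b z Y : ℂ} (hz : z ∈ outPetal b) (h : omegaOut b z = Y) :
    omegaOutInv b Y = z :=
  injOn_omegaOut b (Function.invFunOn_mem ⟨z, hz, h⟩) hz
    ((Function.invFunOn_eq ⟨z, hz, h⟩).trans h.symm)

/-- Picard iteration for `W + b log W = n - Z`, where `s = (b, Z)`. -/
noncomputable def outPicard (n : ℕ) : ℕ → ℂ × ℂ → ℂ
  | 0, _ => n
  | k + 1, s => n - s.2 - s.1 * Complex.log (outPicard n k s)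

/-- The equation for `W = 1 / z` is a fixed-point problem whose iteration contracts on the disc of
radius `n / 4` about `n`. Convergence is uniform in `(b, Z)`, so the inverse is holomorphic in both
variables, as needed when `b` depends on `δ`. -/
theorem exists_omegaOutInv_spec (β ρ : ℝ) : ∃ n₀ : ℕ, ∀ n ≥ n₀, ∀ b Z : ℂ, ‖b‖ < β → ‖Z‖ < ρ →
    (n : ℝ) / 2 ≤ (1 / omegaOutInv b (Z - n)).re ∧
    omegaOut b (omegaOutInv b (Z - n)) = Z - n ∧
    DifferentiableAt ℂ (fun s : ℂ × ℂ => omegaOutInv s.1 (s.2 - n)) (b, Z) := by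
  obtain ⟨C, hC, H⟩ := exists_norm_mul_log_le β
  -- The bound `11 (ρ + C) ≤ n` keeps the iterates in the disc, since `1/11 + 5/32 < 1/4`; `3 β ≤ n`
  -- gives contraction factor `(n / 3) / (3 n / 4) = 4 / 9`.
  obtain ⟨n₀, hn₀⟩ := exists_nat_ge (max 2 (max (11 * (ρ + C)) (3 * β)))
  refine ⟨n₀, fun n hn => ?_⟩
  have hnR : (n₀ : ℝ) ≤ n := by exact_mod_cast hn
  have hn2 : 2 ≤ (n : ℝ) := ((le_max_left _ _).trans hn₀).trans hnR
  have hnC : 11 * (ρ + C) ≤ n :=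
    (((le_max_left _ _).trans (le_max_right _ _)).trans hn₀).trans hnR
  have hnβ : 3 * β ≤ n := (((le_max_right _ _).trans (le_max_right _ _)).trans hn₀).trans hnR
  obtain ⟨U, hUdef⟩ : ∃ U : Set (ℂ × ℂ), U = {s | ‖s.1‖ < β ∧ ‖s.2‖ < ρ} := ⟨_, rfl⟩
  have hU : IsOpen U := hUdef ▸ (isOpen_lt continuous_fst.norm continuous_const).inter
    (isOpen_lt continuous_snd.norm continuous_const)
  have hre : ∀ W : ℂ, ‖W - n‖ ≤ n / 4 → 3 / 4 * (n : ℝ) ≤ W.re := by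
    intro W hW
    have := (abs_le.1 ((Complex.abs_re_le_norm _).trans hW)).1
    rw [Complex.sub_re, Complex.natCast_re] at this
    linarith
  have hball : ∀ k, ∀ s ∈ U, ‖outPicard n k s - n‖ ≤ n / 4 := by
    intro k s hs
    rw [hUdef] at hs
    induction k with
    | zero => simp only [outPicard, sub_self, norm_zero]; positivity
    | succ k ih =>
      have h1 := H s.1 (outPicard n k s) hs.1.le (by linarith [hre _ ih])
      have h2 : ‖outPicard n k s‖ ≤ n / 4 + n := by
        have := norm_add_le (outPicard n k s - n) (n : ℂ)
        rw [sub_add_cancel, Complex.norm_natCast] at this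
        linarith
      have e : outPicard n (k + 1) s - n = -(s.2 + s.1 * Complex.log (outPicard n k s)) := by
        rw [outPicard]; ring
      rw [e, norm_neg]
      refine (norm_add_le _ _).trans ?_
      linarith [hs.2]
  have hcontr : ∀ k, ∀ s ∈ U,
      ‖outPicard n (k + 1) s - outPicard n k s‖ ≤ n / 4 * (1 / 2) ^ k := by
    intro k s hs
    induction k with
    | zero => simpa [outPicard] using hball 1 s hs
    | succ k ih =>
      have e : outPicard n (k + 1 + 1) s - outPicard n (k + 1) s =
          -(s.1 * (Complex.log (outPicard n (k + 1) s) - Complex.log (outPicard n k s))) := by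
        rw [outPicard, outPicard]; ring
      have h1 := norm_log_sub_log_le (by positivity : 0 < 3 / 4 * (n : ℝ)) (hre _ (hball k s hs))
        (hre _ (hball (k + 1) s hs))
      have hb : ‖s.1‖ ≤ n / 3 := by rw [hUdef] at hs; linarith [hs.1]
      rw [e, norm_neg, norm_mul]
      calc _ ≤ n / 3 * ((3 / 4 * (n : ℝ))⁻¹ * (n / 4 * (1 / 2) ^ k)) := by
            gcongr; exact h1.trans (by gcongr)
        _ = 4 / 9 * (n / 4 * (1 / 2) ^ k) := by field_simp; norm_num
        _ ≤ 1 / 2 * (n / 4 * (1 / 2) ^ k) := mul_le_mul_of_nonneg_right (by norm_num)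
          (by positivity)
        _ = _ := by rw [pow_succ]; ring
  obtain ⟨G, hG⟩ := tendstoUniformlyOn_of_summable_norm_sub
    ((summable_geometric_of_lt_one (by norm_num) (by norm_num : (1 / 2 : ℝ) < 1)).mul_left
      ((n : ℝ) / 4)) hcontr
  have hGball : ∀ s ∈ U, ‖G s - n‖ ≤ n / 4 := fun s hs =>
    le_of_tendsto ((hG.tendsto_at hs).sub_const _).norm
      (Eventually.of_forall fun k => hball k s hs)
  have hGpos : ∀ s ∈ U, 0 < (G s).re := fun s hs => by linarith [hre _ (hGball s hs)]
  have hGeq : ∀ s ∈ U, G s = n - s.2 - s.1 * Complex.log (G s) := fun s hs => by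
    have h1 : Tendsto (fun k => outPicard n (k + 1) s) atTop
        (𝓝 (n - s.2 - s.1 * Complex.log (G s))) :=
      ((hG.tendsto_at hs).clog (Or.inl (hGpos s hs))).const_mul s.1 |>.const_sub _
    exact tendsto_nhds_unique ((tendsto_add_atTop_iff_nat 1).2 (hG.tendsto_at hs)) h1
  have hinv : ∀ s ∈ U, omegaOutInv s.1 (s.2 - n) = 1 / G s ∧
      omegaOut s.1 (1 / G s) = s.2 - n := fun s hs => by
    have h2 : omegaOut s.1 (1 / G s) = s.2 - n := by
      rw [omegaOut_eq, one_div_one_div]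
      linear_combination -(hGeq s hs)
    refine ⟨omegaOutInv_eq ?_ h2, h2⟩
    rw [outPetal, Set.mem_ofPred_eq, one_div_one_div]
    rw [hUdef] at hs
    linarith [hre _ (hGball s (hUdef ▸ hs)), hs.1]
  have hdiff : ∀ k, DifferentiableOn ℂ (outPicard n k) U := by
    intro k
    induction k with
    | zero => exact differentiableOn_const _
    | succ k ih =>
      intro s hs
      have hs' : (outPicard n k s).re > 0 := by linarith [hre _ (hball k s hs)]
      have h3 := (ih s hs).clog (Or.inl hs')
      have h4 : DifferentiableWithinAt ℂ (fun s : ℂ × ℂ => (n : ℂ) - s.2) U s := by fun_prop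
      exact h4.sub (differentiableWithinAt_fst.mul h3)
  intro b Z hb hZ
  have hs : (b, Z) ∈ U := by rw [hUdef]; exact ⟨hb, hZ⟩
  obtain ⟨e1, e2⟩ := hinv _ hs
  simp only at e1 e2
  refine ⟨?_, by rw [e1, e2], ?_⟩
  · rw [e1, one_div_one_div]
    linarith [hre _ (hGball _ hs)]
  · have hGd : DifferentiableAt ℂ G (b, Z) :=
      differentiableAt_of_tendstoUniformlyOn (hU.mem_nhds hs) (Eventually.of_forall hdiff) hG
    have hne : G (b, Z) ≠ 0 := fun h => by have := hGpos _ hs; rw [h] at this; simp at this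
    refine (hGd.const_div_apply 1 hne).congr_of_eventuallyEq ?_
    filter_upwards [hU.mem_nhds hs] with s hs
    exact (hinv s hs).1

/-! ### Repelling orbits and the repelling Fatou coordinate. -/

section Repelling

variable {q : Polynomial ℂ} {d C ε : ℝ}

/-- The weight `A` is chosen so that the contraction of the slope frees exactly `C ‖u‖`, which pays
for the slope error in the outgoing coordinate. The combined quantity then grows only by `O(1 /
τ²)`. -/
theorem StepBound.repelling_step (h : StepBound q d C ε) {δ : ℂ} {x : ℂ × ℂ} {A τ : ℝ}
    (hδ : ‖δ‖ ≤ d) (hτ : 12 ≤ τ) (hτε : 4 / τ ≤ ε) (hx : τ / 4 ≤ (1 / x.1).re)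
    (hux : ‖slope2 δ x‖ ≤ ε) (hA : A * ((1 - d) / 2) = C) (Y : ℂ) :
    1 ≤ (1 / (mapF q δ x).1).re ∧
      ‖omegaOut (logCoeff q δ) (mapF q δ x).1 - (Y + 1)‖ + A * ‖slope2 δ (mapF q δ x)‖ ≤
        ‖omegaOut (logCoeff q δ) x.1 - Y‖ + A * ‖slope2 δ x‖ + 16 * (C + A * C) / τ ^ 2 := by
  have hC := h.one_le
  have hpos : 0 < (1 - d) / 2 := by linarith [h.d_lt_one]
  have hA0 : 0 ≤ A := by
    by_contra hneg
    have := mul_neg_of_neg_of_pos (not_le.1 hneg) hpos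
    linarith
  have hz0 : x.1 ≠ 0 := ne_zero_of_inv_re_pos (by linarith)
  have hzτ : ‖x.1‖ ≤ 4 / τ := by
    have := norm_le_inv_of_le_inv_re (by positivity) hx
    rwa [one_div_div] at this
  have hzε : ‖x.1‖ ≤ ε := hzτ.trans hτε
  obtain ⟨-, s2, s3⟩ := h.step δ x hδ hz0 hzε hux
  have hre' : 1 ≤ (1 / (mapF q δ x).1).re := by
    have h1 := (abs_le.1 ((Complex.abs_re_le_norm _).trans s2)).2
    rw [Complex.sub_re, Complex.sub_re, Complex.one_re] at h1
    linarith
  refine ⟨hre', ?_⟩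
  have s4 := h.step_out δ x hδ hz0 hzε hux (by linarith) (by linarith)
  generalize logCoeff q δ = b at *
  have hm2 : ‖x.1‖ ^ 2 ≤ 16 / τ ^ 2 := by
    calc ‖x.1‖ ^ 2 ≤ (4 / τ) ^ 2 := by gcongr
      _ = _ := by rw [div_pow]; norm_num
  have e : omegaOut b (mapF q δ x).1 - (Y + 1) =
      (omegaOut b x.1 - Y) + (omegaOut b (mapF q δ x).1 - omegaOut b x.1 - 1) := by ring
  have t1 := norm_add_le (omegaOut b x.1 - Y)
    (omegaOut b (mapF q δ x).1 - omegaOut b x.1 - 1)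
  rw [← e] at t1
  have t2 : A * ‖slope2 δ (mapF q δ x)‖ ≤
      A * ((1 + d) / 2 * ‖slope2 δ x‖ + C * ‖x.1‖ ^ 2) := by gcongr
  have t3 : (C + A * C) * ‖x.1‖ ^ 2 ≤ 16 * (C + A * C) / τ ^ 2 := by
    calc _ ≤ (C + A * C) * (16 / τ ^ 2) := by gcongr
      _ = _ := by ring
  have t5 : A * ((1 + d) / 2 * ‖slope2 δ x‖) = A * ‖slope2 δ x‖ - C * ‖slope2 δ x‖ := by
    rw [← hA]; ring
  linarith

/-- Orbits starting deep in the repelling petal, near the formally invariant curve, follow the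
translation in the outgoing coordinate until they leave the petal. -/
theorem StepBound.exists_repelling_orbit (h : StepBound q d C ε) (M : ℝ) :
    ∃ K c B : ℝ, 12 ≤ K ∧ 0 < c ∧ c ≤ 1 / 4 ∧ 1 ≤ B ∧ ∀ (δ : ℂ) (p : ℂ × ℂ), ‖δ‖ ≤ d →
      1 ≤ (1 / p.1).re → ‖slope2 δ p‖ ≤ c → |(omegaOut (logCoeff q δ) p.1).im| ≤ M →
      ∀ j : ℕ, K ≤ -(omegaOut (logCoeff q δ) p.1).re - j →
        (-(omegaOut (logCoeff q δ) p.1).re - j) / 4 ≤ (1 / ((mapF q δ)^[j] p).1).re ∧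
        ‖slope2 δ ((mapF q δ)^[j] p)‖ ≤ 1 ∧
        ‖omegaOut (logCoeff q δ) ((mapF q δ)^[j] p).1 - omegaOut (logCoeff q δ) p.1 - j‖ ≤
          B * (‖slope2 δ p‖ + 1 / (-(omegaOut (logCoeff q δ) p.1).re - j)) ∧
        ‖slope2 δ ((mapF q δ)^[j] p)‖ ≤
          B * (‖slope2 δ p‖ + 1 / (-(omegaOut (logCoeff q δ) p.1).re - j)) := by
  have hd0 := h.d_nonneg
  have hd := h.d_lt_one
  have hC := h.one_le
  have hε := h.eps_pos
  have hε4 := h.eps_le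
  have hpos : 0 < 1 - d := by linarith
  obtain ⟨K₀, hK₀⟩ := exists_half_le_inv_re C (M + 1)
  obtain ⟨A, hA⟩ : ∃ A, A = 2 * C / (1 - d) := ⟨_, rfl⟩
  have hA' : A * ((1 - d) / 2) = C := by rw [hA]; field_simp
  have hA1 : 1 ≤ A := by rw [hA, le_div_iff₀ hpos]; linarith
  obtain ⟨C₃, hC₃⟩ : ∃ C₃, C₃ = 16 * (C + A * C) := ⟨_, rfl⟩
  have hC₃1 : 1 ≤ C₃ := by
    have : 0 ≤ A * C := by positivity
    linarith
  -- For heights `τ ≥ K`, the term `4 / ε` keeps `‖z‖ ≤ ε`, and `2 C₃ / ε` bounds the accumulated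
  -- drift by `ε / 2`; the initial slope uses the other half, through `c = ε / (2 A)`.
  obtain ⟨K, hK⟩ : ∃ K, K = |K₀| + 13 + 4 / ε + 2 * C₃ / ε := ⟨_, rfl⟩
  have p1 : 0 ≤ 4 / ε := by positivity
  have p2 : 0 ≤ 2 * C₃ / ε := by positivity
  have p3 := le_abs_self K₀
  have p4 := abs_nonneg K₀
  have hKε : 4 / ε ≤ K := by linarith
  have hKC : 2 * C₃ / ε ≤ K := by linarith
  refine ⟨K, ε / (2 * A), max A C₃, by linarith, by positivity, ?_, hA1.trans (le_max_left _ _), ?_⟩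
  · rw [div_le_iff₀ (by positivity)]; linarith
  intro δ p hδ hp hu him
  obtain ⟨b, hb⟩ : ∃ b, logCoeff q δ = b := ⟨_, rfl⟩
  obtain ⟨Ω, hΩ⟩ : ∃ Ω, omegaOut (logCoeff q δ) p.1 = Ω := ⟨_, rfl⟩
  obtain ⟨T, hT⟩ : ∃ T, -Ω.re = T := ⟨_, rfl⟩
  have hbC : ‖b‖ ≤ C := hb ▸ h.logCoeff_le δ hδ
  rw [hΩ] at him
  simp only [hΩ, hT]
  rw [hb] at hΩ
  simp only [hb]
  have hsmall : ∀ τ : ℝ, K ≤ τ → A * ‖slope2 δ p‖ + C₃ / τ ≤ ε := by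
    intro τ hτ
    have h1 : A * ‖slope2 δ p‖ ≤ A * (ε / (2 * A)) := by gcongr
    have h2 : A * (ε / (2 * A)) = ε / 2 := by field_simp
    have h3 : C₃ / τ ≤ ε / 2 := by
      rw [div_le_iff₀ (by linarith)]
      rw [div_le_iff₀ hε] at hKC
      nlinarith
    linarith
  have key : ∀ j : ℕ, K ≤ T - j → (T - j) / 4 ≤ (1 / ((mapF q δ)^[j] p).1).re ∧
      ‖omegaOut b ((mapF q δ)^[j] p).1 - Ω - j‖ + A * ‖slope2 δ ((mapF q δ)^[j] p)‖ ≤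
        A * ‖slope2 δ p‖ + C₃ / (T - j) := by
    intro j
    induction j with
    | zero =>
      intro hj
      rw [Nat.cast_zero, sub_zero] at hj ⊢
      have h1 := hK₀ b p.1 hbC hp (by rw [hΩ]; linarith) (by rw [hΩ, hT]; linarith)
      rw [hΩ, hT] at h1
      refine ⟨by rw [Function.iterate_zero, id]; linarith, ?_⟩
      have : 0 ≤ C₃ / T := div_nonneg (by linarith) (by linarith)
      simp only [Function.iterate_zero, id, hΩ, sub_self, Nat.cast_zero, norm_zero, zero_add]
      linarith
    | succ j ih =>
      intro hj
      push_cast at hj ⊢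
      obtain ⟨ih1, ih2⟩ := ih (by linarith)
      rw [Function.iterate_succ_apply']
      generalize (mapF q δ)^[j] p = x at ih1 ih2
      obtain ⟨τ, hτ⟩ : ∃ τ, T - j = τ := ⟨_, rfl⟩
      have hτ1 : T - (j + 1) = τ - 1 := by rw [← hτ]; ring
      rw [hτ1] at hj ⊢
      rw [hτ] at ih1 ih2
      have hτK : K ≤ τ := by linarith
      have hτ0 : 0 < τ := by linarith
      have h4τ : 4 / τ ≤ ε := by
        rw [div_le_iff₀ hτ0]
        rw [div_le_iff₀ hε] at hKε
        nlinarith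
      have hsε := hsmall τ hτK
      have hux : ‖slope2 δ x‖ ≤ ε := by
        have h1 : ‖slope2 δ x‖ ≤ A * ‖slope2 δ x‖ := le_mul_of_one_le_left (norm_nonneg _) hA1
        linarith [norm_nonneg (omegaOut b x.1 - Ω - j)]
      obtain ⟨hre', hE₀⟩ := h.repelling_step hδ (by linarith) h4τ ih1 hux hA' (Ω + j)
      rw [hb] at hE₀
      have hE : ‖omegaOut b (mapF q δ x).1 - Ω - (j + 1)‖ + A * ‖slope2 δ (mapF q δ x)‖ ≤
          A * ‖slope2 δ p‖ + C₃ / (τ - 1) := by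
        -- The per-step error telescopes against the decreasing height `τ = T - j`.
        have t4 : C₃ / τ + C₃ / τ ^ 2 ≤ C₃ / (τ - 1) := by
          have : 0 < τ - 1 := by linarith
          rw [div_add_div _ _ hτ0.ne' (by positivity), div_le_div_iff₀ (by positivity) this]
          have h5 : 0 ≤ C₃ * τ := by positivity
          nlinarith
        rw [sub_sub, ← add_assoc]
        rw [sub_sub] at ih2
        rw [← hC₃] at hE₀
        linarith
      refine ⟨?_, hE⟩
      have hs' := hsmall (τ - 1) hj
      have hdist : ‖omegaOut b (mapF q δ x).1 - Ω - (j + 1)‖ ≤ 1 := by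
        have : 0 ≤ A * ‖slope2 δ (mapF q δ x)‖ := by positivity
        linarith
      have i1 := abs_le.1 ((Complex.abs_im_le_norm _).trans hdist)
      have i2 := abs_le.1 ((Complex.abs_re_le_norm _).trans hdist)
      simp only [Complex.sub_im, Complex.add_im, Complex.natCast_im, Complex.one_im, add_zero,
        sub_zero] at i1
      simp only [Complex.sub_re, Complex.add_re, Complex.natCast_re, Complex.one_re] at i2
      have hMi := abs_le.1 him
      -- The outgoing coordinate is off by at most `1` from the exact translate, hence the use of `M
      -- + 1` for `K₀`; it yields `Re (1/z) ≥ (τ - 2) / 2`, which exceeds the required `(τ - 1) /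
      -- 4`.
      have h7 : τ - 1 - 1 ≤ -(omegaOut b (mapF q δ x).1).re := by linarith
      have h8 := hK₀ b (mapF q δ x).1 hbC hre'
        (abs_le.2 ⟨by linarith, by linarith⟩) (by linarith)
      linarith
  intro j hj
  obtain ⟨k1, k2⟩ := key j hj
  have hτ0 : 0 < T - j := by linarith
  have hA0 : ‖slope2 δ ((mapF q δ)^[j] p)‖ ≤ A * ‖slope2 δ ((mapF q δ)^[j] p)‖ :=
    le_mul_of_one_le_left (norm_nonneg _) hA1
  have hn0 := norm_nonneg (omegaOut b ((mapF q δ)^[j] p).1 - Ω - j)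
  have hn1 := norm_nonneg (slope2 δ ((mapF q δ)^[j] p))
  have hbd : A * ‖slope2 δ p‖ + C₃ / (T - j) ≤ max A C₃ * (‖slope2 δ p‖ + 1 / (T - j)) := by
    rw [mul_add, mul_one_div]
    gcongr
    · exact le_max_left _ _
    · exact le_max_right _ _
  exact ⟨k1, by linarith [hsmall _ hj], by linarith, by linarith⟩

end Repelling

section Repelling

variable {q : Polynomial ℂ} {d C ε : ℝ}

/-- The approximate repelling Fatou coordinates, `s = (δ, Z)`. -/
noncomputable def repellingApprox (q : Polynomial ℂ) (n : ℕ) (s : ℂ × ℂ) : ℂ × ℂ :=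
  (mapF q s.1)^[n] (omegaOutInv (logCoeff q s.1) (s.2 - n), 0)

/-- The point with `1 / z = W` and slope `u`. -/
noncomputable def ofInvSlope (δ W u : ℂ) : ℂ × ℂ := (1 / W, 1 / W * (u - 1 / W / (1 - δ)))

theorem slope2_ofInvSlope {δ W u : ℂ} (hW : W ≠ 0) : slope2 δ (ofInvSlope δ W u) = u := by
  rw [slope2, ofInvSlope]
  simp only
  rw [mul_div_cancel_left₀ _ (one_div_ne_zero hW), sub_add_cancel]

theorem ofInvSlope_slope2 {δ : ℂ} {p : ℂ × ℂ} (hp : p.1 ≠ 0) :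
    ofInvSlope δ (1 / p.1) (slope2 δ p) = p := by
  rw [ofInvSlope, one_div_one_div]
  ext
  · rfl
  · exact (snd_eq_slope2 hp).symm

theorem differentiableAt_ofInvSlope {δ : ℂ} {W u : ℂ → ℂ} {h : ℂ} (hW : DifferentiableAt ℂ W h)
    (hu : DifferentiableAt ℂ u h) (hW0 : W h ≠ 0) :
    DifferentiableAt ℂ (fun t => ofInvSlope δ (W t) (u t)) h := by
  have h1 := hW.const_div_apply 1 hW0
  exact h1.prodMk (h1.fun_mul (hu.fun_sub (h1.div_const _)))

theorem exists_norm_iterate_mapF_le (q : Polynomial ℂ) (d r : ℝ) (N : ℕ) :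
    ∃ B : ℝ, 0 ≤ B ∧ ∀ (δ : ℂ) (p : ℂ × ℂ), ‖δ‖ ≤ d → ‖p‖ ≤ r → ‖(mapF q δ)^[N] p‖ ≤ B := by
  obtain ⟨B, hB⟩ := ((isCompact_closedBall (0 : ℂ) d).prod
    (isCompact_closedBall (0 : ℂ × ℂ) r)).exists_bound_of_continuousOn
    (differentiable_iterate_mapF_family q N).continuous.continuousOn
  exact ⟨max B 0, le_max_right _ _, fun δ p hδ hp =>
    (hB (δ, p) ⟨by simpa using hδ, by simpa using hp⟩).trans (le_max_left _ _)⟩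

/-- Points over a disc deep in the repelling petal have uniformly bounded images. -/
theorem StepBound.exists_iterate_bound (h : StepBound q d C ε) (M : ℝ) :
    ∃ c B : ℝ, ∃ n₀ : ℕ, 0 < c ∧ c ≤ 1 / 4 ∧ 0 ≤ B ∧ ∀ n ≥ n₀, ∀ (δ : ℂ) (p : ℂ × ℂ), ‖δ‖ ≤ d →
      1 ≤ (1 / p.1).re → ‖slope2 δ p‖ ≤ c → ‖omegaOut (logCoeff q δ) p.1 + n‖ ≤ M →
      ‖(mapF q δ)^[n] p‖ ≤ B := by
  obtain ⟨K, c, B₁, hK, hc, hc4, hB₁, H⟩ := h.exists_repelling_orbit M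
  -- The first `n - k` steps stay at height at least `K` in the petal; the last `k` steps, a number
  -- independent of `n`, are bounded by compactness.
  obtain ⟨k, hk⟩ := exists_nat_ge (K + M)
  obtain ⟨B, hB, hB'⟩ := exists_norm_iterate_mapF_le q d (1 + (1 - d)⁻¹) k
  refine ⟨c, B, k, hc, hc4, hB, fun n hn δ p hδ hp hu hΩ => ?_⟩
  have him := (Complex.abs_im_le_norm _).trans hΩ
  have hre := abs_le.1 ((Complex.abs_re_le_norm _).trans hΩ)
  rw [Complex.add_im, Complex.natCast_im, add_zero] at him
  rw [Complex.add_re, Complex.natCast_re] at hre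
  have hcast : ((n - k : ℕ) : ℝ) = n - k := by push_cast [hn]; ring
  obtain ⟨h1, h2, -, -⟩ := H δ p hδ hp hu him (n - k) (by rw [hcast]; linarith)
  rw [hcast] at h1
  have hz1 := norm_le_inv_of_le_inv_re one_pos (by linarith : 1 ≤ (1 / ((mapF q δ)^[n - k] p).1).re)
  rw [one_div_one] at hz1
  have hz0 := ne_zero_of_inv_re_pos (by linarith : 0 < (1 / ((mapF q δ)^[n - k] p).1).re)
  have h3 := norm_le_of_slope2 hz0 hz1 h2 (norm_inv_one_sub_le h.d_lt_one hδ)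
  have hinv : 0 < (1 - d)⁻¹ := by
    have : 0 < 1 - d := by linarith [h.d_lt_one]
    positivity
  have h4 := hB' δ _ hδ (h3.trans (mul_le_of_le_one_right (by linarith) hz1))
  rwa [← Function.iterate_add_apply, Nat.add_sub_cancel' hn] at h4

/-- If two points deep in the repelling petal have nearby outgoing coordinates and small slopes,
their images at bounded height are close. -/
theorem StepBound.exists_dist_iterate_le (h : StepBound q d C ε) {M B₂ : ℝ} (hB₂ : 1 ≤ B₂) :
    ∃ B : ℝ, ∃ n₀ : ℕ, 0 ≤ B ∧ ∀ n ≥ n₀, ∀ (δ : ℂ) (p p' : ℂ × ℂ), ‖δ‖ ≤ d →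
      (n : ℝ) / 8 ≤ (1 / p.1).re → (n : ℝ) / 8 ≤ (1 / p'.1).re →
      ‖omegaOut (logCoeff q δ) p.1 + n‖ ≤ M → ‖slope2 δ p‖ ≤ B₂ / n → ‖slope2 δ p'‖ ≤ B₂ / n →
      ‖omegaOut (logCoeff q δ) p'.1 - omegaOut (logCoeff q δ) p.1‖ ≤ B₂ / n →
      dist ((mapF q δ)^[n] p') ((mapF q δ)^[n] p) ≤ B / n := by
  have hC := h.one_le
  obtain ⟨c, B, n₁, hc, hc4, hB, H⟩ := h.exists_iterate_bound (M + 1)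
  obtain ⟨n₀, hn₀⟩ := exists_nat_ge (n₁ + 16 * C + 8 * B₂ / c + 10)
  refine ⟨2 * B * (4 * B₂ / c), n₀, by positivity,
    fun n hn δ p p' hδ hp hp' hM hu hu' hΩ => ?_⟩
  have hnR : n₁ + 16 * C + 8 * B₂ / c + 10 ≤ (n : ℝ) := hn₀.trans (by exact_mod_cast hn)
  have q1 : 0 ≤ 8 * B₂ / c := by positivity
  have q2 : (0 : ℝ) ≤ n₁ := n₁.cast_nonneg
  have hn1 : n₁ ≤ n := by
    have : (n₁ : ℝ) ≤ n := by linarith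
    exact_mod_cast this
  have hnpos : (0 : ℝ) < n := by linarith
  have hnc : 8 * B₂ ≤ c * n := by
    have : 8 * B₂ / c ≤ n := by linarith
    rw [div_le_iff₀ hc] at this
    linarith
  have hbC := h.logCoeff_le δ hδ
  have hp0 : p.1 ≠ 0 := ne_zero_of_inv_re_pos (by linarith)
  have hp0' : p'.1 ≠ 0 := ne_zero_of_inv_re_pos (by linarith)
  have hWW : ‖1 / p'.1 - 1 / p.1‖ ≤ 2 * (B₂ / n) :=
    (norm_inv_sub_inv_le (b := logCoeff q δ) (by positivity : (0 : ℝ) < n / 8) (by linarith) hp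
      hp').trans
      (by gcongr)
  have huu : ‖slope2 δ p' - slope2 δ p‖ ≤ 2 * (B₂ / n) :=
    (norm_sub_le _ _).trans (by linarith)
  obtain ⟨W, hW⟩ : ∃ W : ℂ → ℂ, W = fun t => 1 / p.1 + t * (1 / p'.1 - 1 / p.1) := ⟨_, rfl⟩
  obtain ⟨u, hu⟩ : ∃ u : ℂ → ℂ, u = fun t => slope2 δ p + t * (slope2 δ p' - slope2 δ p) :=
    ⟨_, rfl⟩
  -- The complex line through the two points in the coordinates `(1/z, u)` has them at `t = 0` and
  -- `t = 1`. Their gap is `O(1/n)`, so a disc of radius `r` proportional to `n` moves each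
  -- coordinate by at most `c / 2`. The images there are bounded by `B`, and the Schwarz lemma gives
  -- distance at most `2 B / r`.
  obtain ⟨r, hr⟩ : ∃ r : ℝ, r = c * n / (4 * B₂) := ⟨_, rfl⟩
  have hr2 : 2 ≤ r := by rw [hr, le_div_iff₀ (by positivity)]; linarith
  have hrB : r * (2 * (B₂ / n)) = c / 2 := by rw [hr]; field_simp; norm_num
  have hsmall : ∀ (t a : ℂ), t ∈ Metric.ball (0 : ℂ) r → ‖a‖ ≤ 2 * (B₂ / n) →
      ‖t * a‖ ≤ c / 2 := by
    intro t a ht ha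
    rw [mem_ball_zero_iff] at ht
    rw [norm_mul, ← hrB]
    gcongr
  have hWclose : ∀ t ∈ Metric.ball (0 : ℂ) r, ‖W t - 1 / p.1‖ ≤ 1 / 8 := fun t ht => by
    have := hsmall t _ ht hWW
    rw [hW]
    simp only [add_sub_cancel_left]
    linarith
  have hWre : ∀ t ∈ Metric.ball (0 : ℂ) r, (n : ℝ) / 8 - 1 / 8 ≤ (W t).re := fun t ht => by
    have h1 := (abs_le.1 ((Complex.abs_re_le_norm _).trans (hWclose t ht))).1
    rw [Complex.sub_re] at h1
    linarith
  have hW0 : ∀ t ∈ Metric.ball (0 : ℂ) r, W t ≠ 0 := fun t ht h0 => by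
    have := hWre t ht
    rw [h0, Complex.zero_re] at this
    linarith
  have hbound : ∀ t ∈ Metric.ball (0 : ℂ) r,
      ‖(mapF q δ)^[n] (ofInvSlope δ (W t) (u t))‖ ≤ B := by
    intro t ht
    have e1 : 1 / (ofInvSlope δ (W t) (u t)).1 = W t := by
      rw [ofInvSlope, one_div_one_div]
    refine H n hn1 δ _ hδ ?_ ?_ ?_
    · rw [e1]; linarith [hWre t ht]
    · rw [slope2_ofInvSlope (hW0 t ht), hu]
      have h1 := hsmall t _ ht huu
      have h2 : B₂ / n ≤ c / 2 := by
        rw [div_le_iff₀ hnpos]; linarith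
      exact (norm_add_le _ _).trans (by linarith)
    · have h1 := norm_omegaOut_sub_le (by linarith : (0 : ℝ) < n / 8 - 1 / 8) (by linarith)
        (by linarith : (n : ℝ) / 8 - 1 / 8 ≤ (1 / p.1).re) (by rw [e1]; exact hWre t ht)
        (b := logCoeff q δ) (z' := (ofInvSlope δ (W t) (u t)).1)
      rw [e1] at h1
      have h2 := hWclose t ht
      have h3 := norm_add_le (omegaOut (logCoeff q δ) (ofInvSlope δ (W t) (u t)).1 -
        omegaOut (logCoeff q δ) p.1) (omegaOut (logCoeff q δ) p.1 + n)
      rw [← add_assoc, sub_add_cancel] at h3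
      linarith
  have hdiff : DifferentiableOn ℂ (fun t => (mapF q δ)^[n] (ofInvSlope δ (W t) (u t)))
      (Metric.ball 0 r) := by
    intro t ht
    have hWd : DifferentiableAt ℂ W t := by rw [hW]; fun_prop
    have hud : DifferentiableAt ℂ u t := by rw [hu]; fun_prop
    exact ((differentiable_iterate_mapF q δ n _).comp t
      (differentiableAt_ofInvSlope hWd hud (hW0 t ht))).differentiableWithinAt
  have hm0 : (0 : ℂ) ∈ Metric.ball (0 : ℂ) r := Metric.mem_ball_self (by linarith)
  have hm1 : (1 : ℂ) ∈ Metric.ball (0 : ℂ) r := by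
    rw [mem_ball_zero_iff, norm_one]; linarith
  have hS := Complex.dist_le_div_mul_dist_of_mapsTo_ball (R₂ := 2 * B) hdiff (fun t ht => by
    rw [Metric.mem_closedBall, dist_eq_norm]
    refine (norm_sub_le _ _).trans ?_
    linarith [hbound t ht, hbound 0 hm0]) hm1
  have e0 : ofInvSlope δ (W 0) (u 0) = p := by
    rw [hW, hu]
    simp only [zero_mul, add_zero]
    exact ofInvSlope_slope2 hp0
  have e1 : ofInvSlope δ (W 1) (u 1) = p' := by
    rw [hW, hu]
    simp only [one_mul, add_sub_cancel]
    exact ofInvSlope_slope2 hp0'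
  rw [e0, e1, dist_zero_right, norm_one, mul_one] at hS
  refine hS.trans (le_of_eq ?_)
  rw [hr]
  field_simp

theorem slope2_axis (δ z : ℂ) : slope2 δ (z, 0) = z / (1 - δ) := by
  simp [slope2]

/-- The approximate repelling Fatou coordinates form a Cauchy sequence with rate `1 / n`. -/
theorem StepBound.exists_dist_repellingApprox_le (h : StepBound q d C ε) (ρ : ℝ) :
    ∃ B : ℝ, ∃ n₀ : ℕ, 0 ≤ B ∧ ∀ n ≥ n₀, ∀ m ≥ n, ∀ s : ℂ × ℂ, ‖s.1‖ ≤ d → ‖s.2‖ < ρ →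
      dist (repellingApprox q m s) (repellingApprox q n s) ≤ B / n := by
  obtain ⟨K, c, B₁, hK, hc, hc4, hB₁, H⟩ := h.exists_repelling_orbit ρ
  obtain ⟨E, hE⟩ : ∃ E, E = (1 - d)⁻¹ := ⟨_, rfl⟩
  have hE1 : 1 ≤ E := by
    rw [hE]; exact (one_le_inv₀ (by linarith [h.d_lt_one])).2 (by linarith [h.d_nonneg])
  obtain ⟨B₂, hB₂⟩ : ∃ B₂, B₂ = B₁ * (2 * E + 2) := ⟨_, rfl⟩
  have hB₂1 : 2 * E + 2 ≤ B₂ := by rw [hB₂]; exact le_mul_of_one_le_left (by linarith) hB₁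
  obtain ⟨n₁, hn₁⟩ := exists_omegaOutInv_spec (C + 1) ρ
  obtain ⟨B, n₂, hB, HB⟩ := h.exists_dist_iterate_le (M := ρ) (by linarith : 1 ≤ B₂)
  obtain ⟨n₃, hn₃⟩ := exists_nat_ge (2 * K + 2 * |ρ| + 2 * E / c + 4)
  refine ⟨B, max n₁ (max n₂ n₃), hB, fun n hn m hm s hδ hZ => ?_⟩
  have g1 : n₁ ≤ n := (le_max_left _ _).trans hn
  have g2 : n₂ ≤ n := ((le_max_left _ _).trans (le_max_right _ _)).trans hn
  have g3 : (n₃ : ℝ) ≤ n := by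
    exact_mod_cast ((le_max_right _ _).trans (le_max_right _ _)).trans hn
  have g4 := hn₃.trans g3
  obtain ⟨δ, Z⟩ := s
  simp only at hδ hZ
  have q1 : 0 ≤ 2 * E / c := by positivity
  have q2 := abs_nonneg ρ
  have q3 := le_abs_self ρ
  have hnpos : (0 : ℝ) < n := by linarith
  have hmn : (n : ℝ) ≤ m := by exact_mod_cast hm
  have hbC : ‖logCoeff q δ‖ < C + 1 := by linarith [h.logCoeff_le δ hδ]
  have hEn : 2 * E ≤ c * n := by
    have : 2 * E / c ≤ n := by linarith
    rw [div_le_iff₀ hc] at this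
    linarith
  have haxis : ∀ k ≥ n, 1 ≤ (1 / omegaOutInv (logCoeff q δ) (Z - k)).re ∧
      (k : ℝ) / 2 ≤ (1 / omegaOutInv (logCoeff q δ) (Z - k)).re ∧
      ‖slope2 δ (omegaOutInv (logCoeff q δ) (Z - k), 0)‖ ≤ 2 * E / n := by
    intro k hk
    have hkR : (n : ℝ) ≤ k := by exact_mod_cast hk
    obtain ⟨a1, -, -⟩ := hn₁ k (g1.trans hk) _ Z hbC hZ
    refine ⟨by linarith, a1, ?_⟩
    have a2 := norm_le_inv_of_le_inv_re (by linarith : (0 : ℝ) < k / 2) a1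
    rw [slope2_axis, div_eq_mul_inv, norm_mul]
    calc _ ≤ 1 / ((n : ℝ) / 2) * E := by
          gcongr
          · refine a2.trans ?_
            gcongr
          · rw [hE]; exact norm_inv_one_sub_le h.d_lt_one hδ
      _ = _ := by field_simp
  obtain ⟨am1, -, am3⟩ := haxis m hm
  obtain ⟨an1, an2, an3⟩ := haxis n le_rfl
  have eΩm := (hn₁ m (g1.trans hm) _ Z hbC hZ).2.1
  have eΩn := (hn₁ n g1 _ Z hbC hZ).2.1
  have hZre := abs_le.1 ((Complex.abs_re_le_norm Z).trans hZ.le)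
  have hcast : ((m - n : ℕ) : ℝ) = m - n := by push_cast [hm]; ring
  have hcastC : ((m - n : ℕ) : ℂ) = m - n := by push_cast [hm]; ring
  have hre : (Z - (m : ℂ)).re = Z.re - m := by simp
  obtain ⟨o1, -, o3, o4⟩ := H δ (omegaOutInv (logCoeff q δ) (Z - m), 0) hδ am1
    (am3.trans (by rw [div_le_iff₀ hnpos]; linarith))
    (by
      rw [eΩm, Complex.sub_im, Complex.natCast_im, sub_zero]
      exact (Complex.abs_im_le_norm Z).trans hZ.le)
    (m - n) (by rw [eΩm, hcast, hre]; linarith)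
  simp only [eΩm, hcast, hre, hcastC] at o1 o3 o4
  have hτ : -(Z.re - m) - ((m : ℝ) - n) = n - Z.re := by ring
  rw [hτ] at o1 o3 o4
  have hτn : (n : ℝ) / 2 ≤ n - Z.re := by linarith
  have hfin : B₁ * (‖slope2 δ (omegaOutInv (logCoeff q δ) (Z - m), 0)‖ + 1 / (n - Z.re)) ≤
      B₂ / n := by
    have h1 : 1 / (n - Z.re) ≤ 2 / n := by
      rw [div_le_div_iff₀ (by linarith) hnpos]; linarith
    calc _ ≤ B₁ * (2 * E / n + 2 / n) := by gcongr
      _ = _ := by rw [hB₂]; ring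
  -- Both points have outgoing coordinate `Z - n` up to `O(1/n)`. Their slopes are `O(1/n)` too,
  -- because an axis point has slope `z / (1 - δ)`.
  have hres := HB n g2 δ (omegaOutInv (logCoeff q δ) (Z - n), 0)
    ((mapF q δ)^[m - n] (omegaOutInv (logCoeff q δ) (Z - m), 0)) hδ (by simp only; linarith)
    (by linarith) (by rw [eΩn, sub_add_cancel]; exact hZ.le)
    (an3.trans (by gcongr; linarith)) (o4.trans hfin)
    (by
      rw [eΩn]
      have e : ∀ X : ℂ, X - (Z - n) = X - (Z - m) - (m - n) := fun X => by ring
      rw [e]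
      exact o3.trans hfin)
  rw [← Function.iterate_add_apply, Nat.add_sub_cancel' hm] at hres
  exact hres

/-- The repelling Fatou coordinate of `mapF q δ`. -/
noncomputable def repellingFatou (q : Polynomial ℂ) (δ Z : ℂ) : ℂ × ℂ :=
  limUnder atTop fun n : ℕ => repellingApprox q n (δ, Z)

theorem StepBound.tendstoUniformlyOn_repellingApprox (h : StepBound q d C ε) (ρ : ℝ) :
    TendstoUniformlyOn (repellingApprox q) (fun s => repellingFatou q s.1 s.2) atTop
      {s | ‖s.1‖ ≤ d ∧ ‖s.2‖ < ρ} := by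
  obtain ⟨B, n₀, hB, H⟩ := h.exists_dist_repellingApprox_le ρ
  have hC : UniformCauchySeqOn (repellingApprox q) atTop {s | ‖s.1‖ ≤ d ∧ ‖s.2‖ < ρ} := by
    rw [Metric.uniformCauchySeqOn_iff]
    intro η hη
    have hlim : Tendsto (fun n : ℕ => B / (n : ℝ)) atTop (𝓝 0) :=
      tendsto_const_nhds.div_atTop tendsto_natCast_atTop_atTop
    obtain ⟨N, hN, hNn⟩ :=
      ((hlim.eventually (gt_mem_nhds (half_pos hη))).and (eventually_ge_atTop n₀)).exists
    refine ⟨N, fun m hm n hn s hs => ?_⟩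
    have h1 := H N hNn m hm s hs.1 hs.2
    have h2 := H N hNn n hn s hs.1 hs.2
    exact (dist_triangle_right _ _ _).trans_lt (by linarith)
  exact hC.tendstoUniformlyOn_of_tendsto fun s hs => (hC.cauchySeq hs).tendsto_limUnder

theorem StepBound.differentiableAt_repellingFatou (h : StepBound q d C ε) {s₀ : ℂ × ℂ}
    (hδ : ‖s₀.1‖ < d) : DifferentiableAt ℂ (fun s : ℂ × ℂ => repellingFatou q s.1 s.2) s₀ := by
  obtain ⟨ρ, hρ⟩ := exists_gt ‖s₀.2‖
  have hU : {s : ℂ × ℂ | ‖s.1‖ < d ∧ ‖s.2‖ < ρ} ∈ 𝓝 s₀ :=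
    (continuous_fst.norm.continuousAt.eventually (gt_mem_nhds hδ)).and
      (continuous_snd.norm.continuousAt.eventually (gt_mem_nhds hρ))
  obtain ⟨n₁, hn₁⟩ := exists_omegaOutInv_spec (C + 1) ρ
  refine differentiableAt_of_tendstoUniformlyOn (f := repellingApprox q) hU ?_
    ((h.tendstoUniformlyOn_repellingApprox ρ).mono fun s hs => ⟨hs.1.le, hs.2⟩)
  filter_upwards [eventually_ge_atTop n₁] with n hn s hs
  have hbC : ‖logCoeff q s.1‖ < C + 1 := by linarith [h.logCoeff_le s.1 hs.1.le]
  have h1 := (hn₁ n hn _ _ hbC hs.2).2.2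
  have hb : DifferentiableAt ℂ (fun s : ℂ × ℂ => (logCoeff q s.1, s.2)) s :=
    ((differentiableAt_logCoeff q (hs.1.trans h.d_lt_one)).comp s differentiableAt_fst).prodMk
      differentiableAt_snd
  have h2 : DifferentiableAt ℂ (fun s : ℂ × ℂ => omegaOutInv (logCoeff q s.1) (s.2 - n)) s :=
    DifferentiableAt.comp (g := fun s : ℂ × ℂ => omegaOutInv s.1 (s.2 - n)) s h1 hb
  have h3 : DifferentiableAt ℂ
      (fun s : ℂ × ℂ => (s.1, (omegaOutInv (logCoeff q s.1) (s.2 - n), (0 : ℂ)))) s :=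
    differentiableAt_fst.prodMk (h2.prodMk (differentiableAt_const _))
  exact ((differentiable_iterate_mapF_family q n _).comp s h3).differentiableWithinAt

end Repelling

/-! ### Assembly and degeneration at `δ = 0`. -/

section Main

variable {q : Polynomial ℂ}

theorem exists_stepBound_of_norm_lt_one (h0 : q.coeff 0 = 0) (h1 : q.coeff 1 = 0)
    (h2 : q.coeff 2 = 1) {δ : ℂ} (hδ : ‖δ‖ < 1) :
    ∃ d C ε R : ℝ, ‖δ‖ < d ∧ StepBound q d C ε ∧ PetalRadius d C ε R := by
  obtain ⟨d, hd, hd1⟩ := exists_between hδ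
  obtain ⟨C, ε, h⟩ := exists_stepBound q h0 h1 h2 ((norm_nonneg δ).trans hd.le) hd1
  obtain ⟨R, hR⟩ := h.exists_petalRadius
  exact ⟨d, C, ε, R, hd, h, hR⟩

theorem isOpen_basinFamily (h0 : q.coeff 0 = 0) (h1 : q.coeff 1 = 0) (h2 : q.coeff 2 = 1) :
    IsOpen (basinFamily q) := by
  rw [isOpen_iff_mem_nhds]
  rintro s₀ ⟨hδ, hp⟩
  obtain ⟨d, C, ε, R, hd, h, hR⟩ := exists_stepBound_of_norm_lt_one h0 h1 h2 hδ
  obtain ⟨N, hN⟩ := h.exists_iterate_mem_attractingPetal hR h0 h1 hd.le hp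
  have h4 := hR.four_le h
  filter_upwards [continuous_fst.norm.continuousAt.eventually (gt_mem_nhds hd),
    eventually_iterate_mem_attractingPetal (by linarith) hδ hN] with s hs hsN
  exact ⟨lt_trans hs h.d_lt_one, h.mem_parabolicBasin hR (le_of_lt hs) hsN⟩

theorem differentiableOn_attractingFatou_family (h0 : q.coeff 0 = 0) (h1 : q.coeff 1 = 0)
    (h2 : q.coeff 2 = 1) :
    DifferentiableOn ℂ (fun s : ℂ × (ℂ × ℂ) => attractingFatou q s.1 s.2) (basinFamily q) := by
  rintro s ⟨hδ, hp⟩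
  obtain ⟨d, C, ε, R, hd, h, hR⟩ := exists_stepBound_of_norm_lt_one h0 h1 h2 hδ
  obtain ⟨N, hN⟩ := h.exists_iterate_mem_attractingPetal hR h0 h1 hd.le hp
  exact (h.differentiableAt_attractingFatou hR hd hN).differentiableWithinAt

theorem isAttractingFatouCoordinate_attractingFatou (h0 : q.coeff 0 = 0) (h1 : q.coeff 1 = 0)
    (h2 : q.coeff 2 = 1) {δ : ℂ} (hδ : ‖δ‖ < 1) :
    IsAttractingFatouCoordinate (mapF q δ) Prod.fst (logCoeff q δ) (attractingFatou q δ) := by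
  obtain ⟨d, C, ε, R, hd, h, hR⟩ := exists_stepBound_of_norm_lt_one h0 h1 h2 hδ
  have hlim : ∀ p ∈ parabolicBasin (mapF q δ),
      Tendsto (fun n : ℕ => attractingApprox q n (δ, p)) atTop (𝓝 (attractingFatou q δ p)) := by
    intro p hp
    obtain ⟨N, hN⟩ := h.exists_iterate_mem_attractingPetal hR h0 h1 hd.le hp
    exact h.tendsto_attractingApprox hR hd.le hN
  have hmaps : Set.MapsTo (mapF q δ) (parabolicBasin (mapF q δ)) (parabolicBasin (mapF q δ)) := by
    intro p hp
    obtain ⟨N, hN⟩ := h.exists_iterate_mem_attractingPetal hR h0 h1 hd.le hp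
    -- Forward invariance of the basin follows from that of the petal, so `δ = 0` is included.
    refine h.mem_parabolicBasin hR hd.le (N := N) ?_
    rw [← Function.iterate_succ_apply, Function.iterate_succ_apply']
    exact (h.petal_orbit hR hd.le hN 1).1
  refine ⟨?_, hmaps, fun p hp => ?_, hlim⟩
  · intro p hp
    have h3 := differentiableOn_attractingFatou_family h0 h1 h2
    have h4 := (h3 (δ, p) ⟨hδ, hp⟩).differentiableAt
      ((isOpen_basinFamily h0 h1 h2).mem_nhds ⟨hδ, hp⟩)
    exact (h4.comp (f := fun p : ℂ × ℂ => (δ, p)) p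
      ((differentiableAt_const δ).prodMk differentiableAt_id)).differentiableWithinAt
  · have h3 := ((tendsto_add_atTop_iff_nat 1).2 (hlim p hp)).add_const (1 : ℂ)
    refine tendsto_nhds_unique (hlim _ (hmaps hp)) (h3.congr fun n => ?_)
    rw [attractingApprox_add]
    simp

theorem isRepellingFatouCoordinate_repellingFatou (h0 : q.coeff 0 = 0) (h1 : q.coeff 1 = 0)
    (h2 : q.coeff 2 = 1) {δ : ℂ} (hδ : ‖δ‖ < 1) :
    IsRepellingFatouCoordinate (mapF q δ) (fun z => (z, 0)) (logCoeff q δ)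
      (repellingFatou q δ) := by
  obtain ⟨d, C, ε, R, hd, h, -⟩ := exists_stepBound_of_norm_lt_one h0 h1 h2 hδ
  have hlim : ∀ Z : ℂ,
      Tendsto (fun n : ℕ => repellingApprox q n (δ, Z)) atTop (𝓝 (repellingFatou q δ Z)) :=
    fun Z => (h.tendstoUniformlyOn_repellingApprox (‖Z‖ + 1)).tendsto_at (x := (δ, Z))
      ⟨hd.le, by simp⟩
  refine ⟨fun Z => ?_, fun Z => ?_, hlim⟩
  · exact (h.differentiableAt_repellingFatou (s₀ := (δ, Z)) hd).comp
      (f := fun Z : ℂ => (δ, Z)) Z ((differentiableAt_const δ).prodMk differentiableAt_id)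
  · have hc : Continuous (mapF q δ) := (differentiable_iterate_mapF q δ 1).continuous
    have h3 := (hc.tendsto _).comp (hlim Z)
    -- Since `(Z + 1) - (n + 1) = Z - n`, the approximant of index `n + 1` at `Z + 1` is the image
    -- under the map of that of index `n` at `Z`.
    refine tendsto_nhds_unique h3 (((tendsto_add_atTop_iff_nat 1).2 (hlim (Z + 1))).congr
      fun n => ?_)
    simp only [repellingApprox, Function.comp_apply, Function.iterate_succ_apply']
    congr 3
    push_cast
    ring_nf

theorem logCoeff_zero (q : Polynomial ℂ) : logCoeff q 0 = 1 - q.coeff 3 := by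
  simp [logCoeff]

theorem fst_mapF_zero (q : Polynomial ℂ) (p : ℂ × ℂ) : (mapF q 0 p).1 = mapf q p.1 :=
  fst_mapF_zero_iterate q 1 p

theorem attractingFatou_zero (q : Polynomial ℂ) (p : ℂ × ℂ) :
    attractingFatou q 0 p = attractingFatou q 0 (p.1, 0) := by
  simp only [attractingFatou, attractingApprox, fst_mapF_zero_iterate]

/-- No separate one-dimensional construction is needed: at `δ = 0` the orbit of `z` ignores `x`, so
the coordinate restricted to the axis inherits every property. -/
theorem isAttractingFatouCoordinate_mapf (h0 : q.coeff 0 = 0) (h1 : q.coeff 1 = 0)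
    (h2 : q.coeff 2 = 1) :
    IsAttractingFatouCoordinate (mapf q) id (1 - q.coeff 3)
      (fun z => attractingFatou q 0 (z, 0)) := by
  have H := isAttractingFatouCoordinate_attractingFatou h0 h1 h2 (δ := 0) (by simp)
  have hB : ∀ p : ℂ × ℂ, p ∈ parabolicBasin (mapF q 0) ↔ p.1 ∈ parabolicBasin (mapf q) :=
    fun p => by rw [parabolicBasin_mapF_zero, Set.mem_ofPred_eq]
  refine ⟨?_, fun z hz => ?_, fun z hz => ?_, fun z hz => ?_⟩
  · exact H.differentiableOn.comp (f := fun z : ℂ => (z, (0 : ℂ)))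
      (differentiable_id.prodMk (differentiable_const _)).differentiableOn
      fun z hz => (hB (z, 0)).2 hz
  · have h3 := (hB _).1 (H.mapsTo ((hB (z, 0)).2 hz))
    rwa [fst_mapF_zero] at h3
  · have h3 := H.abel _ ((hB (z, 0)).2 hz)
    rwa [attractingFatou_zero, fst_mapF_zero] at h3
  · have h3 := H.tendsto _ ((hB (z, 0)).2 hz)
    simpa only [logCoeff_zero, fst_mapF_zero_iterate, id_eq] using h3

theorem isRepellingFatouCoordinate_mapf (h0 : q.coeff 0 = 0) (h1 : q.coeff 1 = 0)
    (h2 : q.coeff 2 = 1) :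
    IsRepellingFatouCoordinate (mapf q) id (1 - q.coeff 3)
      (fun Z => (repellingFatou q 0 Z).1) := by
  have H := isRepellingFatouCoordinate_repellingFatou h0 h1 h2 (δ := 0) (by simp)
  refine ⟨H.differentiable.fst, fun Z => ?_, fun Z => ?_⟩
  · rw [← H.abel Z, fst_mapF_zero]
  · have h3 := (continuous_fst.tendsto _).comp (H.tendsto Z)
    refine h3.congr fun n => ?_
    simp only [Function.comp_apply, fst_mapF_zero_iterate, logCoeff_zero, id]

end Main

theorem mainTheorem4 (q : Polynomial ℂ) (h0 : q.coeff 0 = 0) (h1 : q.coeff 1 = 0)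
    (h2 : q.coeff 2 = 1) :
    ∃ (φ ψ : ℂ → ℂ) (Φ : ℂ → ℂ × ℂ → ℂ) (Ψ : ℂ → ℂ → ℂ × ℂ),
      -- the one-dimensional Fatou coordinates of `f`
      IsAttractingFatouCoordinate (mapf q) id (1 - q.coeff 3) φ ∧
      IsRepellingFatouCoordinate (mapf q) id (1 - q.coeff 3) ψ ∧
      -- the two-dimensional Fatou coordinates of `F^δ`, with their functional equations
      (∀ δ : ℂ, ‖δ‖ < 1 →
        IsAttractingFatouCoordinate (mapF q δ) Prod.fst (logCoeff q δ) (Φ δ) ∧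
        IsRepellingFatouCoordinate (mapF q δ) (fun z => (z, 0)) (logCoeff q δ) (Ψ δ)) ∧
      -- holomorphic dependence on `δ`
      IsOpen (basinFamily q) ∧
      DifferentiableOn ℂ (fun s : ℂ × (ℂ × ℂ) => Φ s.1 s.2) (basinFamily q) ∧
      DifferentiableOn ℂ (fun s : ℂ × ℂ => Ψ s.1 s.2) {s | ‖s.1‖ < 1} ∧
      -- degeneration at `δ = 0`
      parabolicBasin (mapF q 0) = {p | p.1 ∈ parabolicBasin (mapf q)} ∧
      (∀ p ∈ parabolicBasin (mapF q 0), Φ 0 p = φ p.1) ∧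
      (∀ Z : ℂ, (Ψ 0 Z).1 = ψ Z) := by
  refine ⟨fun z => attractingFatou q 0 (z, 0), fun Z => (repellingFatou q 0 Z).1,
    attractingFatou q, repellingFatou q, isAttractingFatouCoordinate_mapf h0 h1 h2,
    isRepellingFatouCoordinate_mapf h0 h1 h2, fun δ hδ =>
      ⟨isAttractingFatouCoordinate_attractingFatou h0 h1 h2 hδ,
        isRepellingFatouCoordinate_repellingFatou h0 h1 h2 hδ⟩,
    isOpen_basinFamily h0 h1 h2, differentiableOn_attractingFatou_family h0 h1 h2, ?_,
    parabolicBasin_mapF_zero q, fun p _ => attractingFatou_zero q p, fun _ => rfl⟩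
  intro s hs
  obtain ⟨d, C, ε, R, hd, h, -⟩ := exists_stepBound_of_norm_lt_one h0 h1 h2 hs
  exact (h.differentiableAt_repellingFatou hd).differentiableWithinAt
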